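/- Let $k$ be an algebraically closed field and let $X$ be a smooth proper connected curve of genus $1$ over $k$. Let $\operatorname{Aut}(X)$ denote the group of $k$-automorphisms of $X$. A \emph{group action} on $X$ is a finite subgroup $H\subseteq\operatorname{Aut}(X)$ (of arbitrary order), and its \emph{stabilized locus} is the set of closed points $P$ of $X$ whose stabilizer $\{h\in H : h(P)=P\}$ is nontrivial. Let $S$ be a finite set of closed points of $X$. Then there exist only finitely many group actions $H\subseteq\operatorname{Aut}(X)$ on $X$ whose stabilized locus is nonempty and contained in $S$. -/

import Mathlib

open AlgebraicGeometry CategoryTheory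

universe u

noncomputable section

namespace CurveAction

section Genus

variable {k : Type u} [Field k] {X : Scheme.{u}} [IsIntegral X]

/-- The function field `κ(X)` of an integral scheme `X` over `k`. The structure morphism `f` is
recorded in the type so that `κ(X)` can carry its `k`-algebra structure. -/
@[nolint unusedArguments]
def FunField (_f : X ⟶ Spec (.of k)) : Type u := X.functionField

instance (f : X ⟶ Spec (.of k)) : Field (FunField f) :=
  inferInstanceAs (Field X.functionField)

/-- The map `k → Γ(X, 𝒪_X)` given by the structure morphism. -/
def globalScalars (f : X ⟶ Spec (.of k)) : CommRingCat.of k ⟶ Γ(X, ⊤) :=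
  (Scheme.ΓSpecIso (.of k)).inv ≫ f.appTop

/-- The `k`-algebra structure `k → Γ(X, 𝒪_X) → κ(X)` on the function field. -/
instance (f : X ⟶ Spec (.of k)) : Algebra k (FunField f) :=
  RingHom.toAlgebra (R := k) (S := X.functionField)
    (globalScalars f ≫ X.presheaf.germ ⊤ (genericPoint X) (TopologicalSpace.Opens.mem_top _)).hom

/-- The local ring `𝒪_{X,x}` of `X` at `x`, as a `k`-subspace of the function field `κ(X)`. -/
def localRing (f : X ⟶ Spec (.of k)) (x : X) : Submodule k (FunField f) where
  carrier := Set.range (algebraMap (X.presheaf.stalk x) X.functionField)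
  add_mem' := by
    rintro _ _ ⟨a, rfl⟩ ⟨b, rfl⟩
    exact ⟨a + b, map_add _ _ _⟩
  zero_mem' := ⟨0, map_zero _⟩
  smul_mem' := by
    rintro c _ ⟨a, rfl⟩
    have hx : x ∈ (⊤ : X.Opens) := TopologicalSpace.Opens.mem_top x
    refine ⟨X.presheaf.germ ⊤ x hx ((globalScalars f).hom c) * a, (map_mul _ _ _).trans ?_⟩
    have : Nonempty (⊤ : X.Opens) := ⟨⟨x, hx⟩⟩
    exact congrArg (· * algebraMap (X.presheaf.stalk x) X.functionField a)
      (Scheme.algebraMap_germ_eq_germToFunctionField X hx ((globalScalars f).hom c))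

/-- The `k`-space of repartitions (adeles) of the curve `X`: families `(r_x)` of elements of
`κ(X)`, indexed by the closed points `x` of `X`, with `r_x ∈ 𝒪_{X,x}` for all but finitely many
`x`. -/
def repartitions (f : X ⟶ Spec (.of k)) : Submodule k (closedPoints X → FunField f) where
  carrier := {r | {x : closedPoints X | r x ∉ localRing f x}.Finite}
  add_mem' := by
    intro r s hr hs
    refine (hr.union hs).subset fun x hx => ?_
    by_contra h
    simp only [Set.mem_union, Set.mem_ofPred_eq, not_or, not_not] at h
    exact hx (add_mem h.1 h.2)
  zero_mem' := by simp
  smul_mem' := by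
    intro c r hr
    exact hr.subset fun x hx h => hx (Submodule.smul_mem _ c h)

/-- The families `(r_x)` with `r_x ∈ 𝒪_{X,x}` for all closed points `x`. -/
def integralRepartitions (f : X ⟶ Spec (.of k)) : Submodule k (closedPoints X → FunField f) :=
  Submodule.pi Set.univ fun x => localRing f x

/-- The constant families `(r)_x`, with `r ∈ κ(X)`. -/
def principalRepartitions (f : X ⟶ Spec (.of k)) : Submodule k (closedPoints X → FunField f) :=
  LinearMap.range (LinearMap.pi fun _ => LinearMap.id : FunField f →ₗ[k] _)

/-- The first cohomology `H¹(X, 𝒪_X)` of the structure sheaf of a curve `X` over `k`, computed from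
the flasque resolution `0 → 𝒪_X → κ(X) → ⨁_x κ(X)/𝒪_{X,x} → 0`. It is the cokernel of
`κ(X) → ⨁_x κ(X)/𝒪_{X,x}`, that is, the space of repartitions modulo the sum of the integral
and the principal ones. -/
abbrev H1 (f : X ⟶ Spec (.of k)) : Type u :=
  repartitions f ⧸
    (integralRepartitions f ⊔ principalRepartitions f).comap (repartitions f).subtype

/-- The genus `dim_k H¹(X, 𝒪_X)` of a smooth proper curve `X` over an algebraically closed
field `k`. -/
def genus (f : X ⟶ Spec (.of k)) : ℕ := Module.finrank k (H1 f)

end Genus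

section Action

variable {k : Type u} [Field k] {X : Scheme.{u}}

/-- The group `Aut(X)` of `k`-automorphisms of the `k`-scheme `X` with structure morphism `f`. -/
abbrev AutOver (f : X ⟶ Spec (.of k)) : Type u := Aut (Over.mk f)

/-- The action of `Aut(X)` on the points of `X`. -/
instance (f : X ⟶ Spec (.of k)) : MulAction (AutOver f) X where
  smul g P := g.hom.left P
  one_smul _ := rfl
  mul_smul g h P := by
    change (h.hom ≫ g.hom).left P = g.hom.left (h.hom.left P)
    simp

/-- The stabilized locus of a subgroup `H` of `Aut(X)`: the closed points of `X` whose stabilizer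
in `H` is nontrivial. -/
def stabilizedLocus (f : X ⟶ Spec (.of k)) (H : Subgroup (AutOver f)) : Set X :=
  {P | P ∈ closedPoints X ∧ MulAction.stabilizer H P ≠ ⊥}

end Action

end CurveAction

end

/-! The stabilized locus of `H` is stable under `H`, since stabilizers along an orbit are conjugate.
If it is nonempty and inside `S`, some `x ∈ S` is sent into `S` by all of `H`, so `H` lies in the
set of all `g` with `g • x = y` for some `x, y ∈ S`. This set does not depend on `H`, and it is
finite once closed points have finite stabilizers in Aut(X) (`finite_setOf_smul_eq_self`); a finite
set has finitely many subsets.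

Stabilizers are finite by Weierstrass theory, carried out on the function field `K` with the
valuations of the closed points, where `v f = exp n` with `n > 0` means a pole of order `n`. That H¹
is one-dimensional takes the place of Riemann–Roch: of any two principal parts at `p`, some
nontrivial combination comes from a function (`exists_mem_regularAway`), and no function has a
single simple pole (`map_ne_exp_one`). Functions regular away from `p` therefore realise every pole
order `n ≥ 2` but not 1, which gives coordinates `x`, `y` and a Weierstrass equation.

An automorphism fixing `p` acts on `x`, `y` by a change of variables preserving this equation
(`exists_variableChange`) and is determined by it, as `x` and `y` generate `K` (`algHom_ext`). A
singular equation would yield a function with a single simple pole (`Δ_ne_zero`), and a nonsingular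
one has finitely many symmetries in every characteristic (`finite_setOf_smul_eq`).

The link to geometry is that local rings at closed points are discrete valuation rings with residue
field `k`, and that automorphisms act faithfully on rational functions by pullback. -/

namespace CurveAction

/-! ### Pole orders on a function field of genus one -/

open Polynomial WithZero

/-- A function field `K` over `k` together with the discrete valuations attached to the closed
points of a smooth proper curve of genus one. The last two conditions say that the space of
repartitions modulo the integral and the principal ones is one-dimensional. -/
structure GenusOneFunctionField (k K ι : Type*) [Field k] [Field K] [Algebra k K] where
  /-- The valuation attached to a place. -/
  v : ι → Valuation K ℤᵐ⁰
  map_algebraMap (i : ι) (c : k) : c ≠ 0 → v i (algebraMap k K c) = 1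
  exists_residue (i : ι) (f : K) : v i f ≤ 1 → ∃ c : k, v i (f - algebraMap k K c) < 1
  exists_exp (i : ι) (n : ℤ) : ∃ f, v i f = exp n
  finite_poles (f : K) : {i | 1 < v i f}.Finite
  eq_algebraMap (f : K) : (∀ i, v i f ≤ 1) → ∃ c : k, algebraMap k K c = f
  exists_dependent (r s : ι → K) : {i | 1 < v i (r i)}.Finite → {i | 1 < v i (s i)}.Finite →
    ∃ a b : k, (a ≠ 0 ∨ b ≠ 0) ∧ ∃ f : K, ∀ i, v i (f - (a • r i + b • s i)) ≤ 1
  exists_nontrivial : ∃ r : ι → K, {i | 1 < v i (r i)}.Finite ∧ ∀ f : K, ∃ i, 1 < v i (f - r i)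

namespace GenusOneFunctionField

variable {k K ι : Type*} [Field k] [Field K] [Algebra k K] (S : GenusOneFunctionField k K ι)

lemma isTrivialOn (i : ι) : (S.v i).IsTrivialOn k := ⟨fun c hc => S.map_algebraMap i c hc⟩

lemma algebraMap_le_one (i : ι) (c : k) : S.v i (algebraMap k K c) ≤ 1 := by
  rcases eq_or_ne c 0 with rfl | hc
  · simp
  · exact (S.map_algebraMap i c hc).le

lemma map_smul (i : ι) {c : k} (hc : c ≠ 0) (f : K) : S.v i (c • f) = S.v i f := by
  rw [Algebra.smul_def, map_mul, S.map_algebraMap i c hc, one_mul]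

lemma map_smul_le (i : ι) (c : k) (f : K) : S.v i (c • f) ≤ S.v i f := by
  rcases eq_or_ne c 0 with rfl | hc
  · simp
  · exact (S.map_smul i hc f).le

/-- The residue field is `k`, so `f / g` is congruent to a constant; this cancels leading terms. -/
lemma exists_sub_smul_lt (i : ι) {f g : K} (hg : g ≠ 0) (h : S.v i f ≤ S.v i g) :
    ∃ c : k, S.v i (f - c • g) < S.v i g := by
  have hg' : 0 < S.v i g := (S.v i).pos_iff.2 hg
  obtain ⟨c, hc⟩ := S.exists_residue i (f / g) (by
    rw [map_div₀]
    exact div_le_one_of_le₀ h hg'.le)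
  refine ⟨c, ?_⟩
  have : f - c • g = (f / g - algebraMap k K c) * g := by
    rw [Algebra.smul_def]; field_simp
  rw [this, map_mul]
  exact mul_lt_of_lt_one_left hg' hc

lemma le_exp_of_lt_exp_add_one {x : ℤᵐ⁰} {n : ℤ} (h : x < exp (n + 1)) : x ≤ exp n := by
  rcases eq_or_ne x 0 with rfl | hx
  · simp
  · rw [← log_le_iff_le_exp hx]
    rw [← log_lt_iff_lt_exp hx] at h
    omega

lemma exists_sub_smul_le (i : ι) {f g : K} {n : ℤ} (hg : S.v i g = exp (n + 1))
    (h : S.v i f ≤ exp (n + 1)) : ∃ c : k, S.v i (f - c • g) ≤ exp n := by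
  have hg0 : g ≠ 0 := by
    rintro rfl
    exact exp_ne_zero (hg.symm.trans (map_zero _))
  obtain ⟨c, hc⟩ := S.exists_sub_smul_lt i hg0 (h.trans hg.ge)
  exact ⟨c, le_exp_of_lt_exp_add_one (hg ▸ hc)⟩

/-- The functions that are regular at all places different from `p`. -/
def regularAway (p : ι) : Subalgebra k K where
  carrier := {f | ∀ j ≠ p, S.v j f ≤ 1}
  mul_mem' ha hb j hj := by
    rw [map_mul]
    exact mul_le_one' (ha j hj) (hb j hj)
  add_mem' ha hb j hj := (S.v j).map_add_le (ha j hj) (hb j hj)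
  algebraMap_mem' c j _ := S.algebraMap_le_one j c

/-- Two repartitions supported at `i`, with poles of order `m` and `n`, are dependent in H¹. The
function realising the relation has pole order `n` if the second coefficient is nonzero, and `m`
otherwise. -/
lemma exists_mem_regularAway (i : ι) {m n : ℤ} (hm : 1 ≤ m) (hmn : m < n) :
    ∃ f ∈ S.regularAway i, S.v i f = exp m ∨ S.v i f = exp n := by
  classical
  obtain ⟨g, hg⟩ := S.exists_exp i m
  obtain ⟨h, hh⟩ := S.exists_exp i n
  have hfin (g : K) : {j | 1 < S.v j ((Pi.single i g : ι → K) j)}.Finite :=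
    (Set.finite_singleton i).subset fun j hj => by
      by_contra hne
      rw [Set.mem_singleton_iff] at hne
      simp [Pi.single_eq_of_ne hne] at hj
  obtain ⟨a, b, hab, f, hf⟩ := S.exists_dependent _ _ (hfin g) (hfin h)
  have hi := hf i
  rw [Pi.single_eq_same, Pi.single_eq_same] at hi
  have hv : S.v i (a • g + b • h) = exp m ∨ S.v i (a • g + b • h) = exp n := by
    by_cases hb : b = 0
    · left
      rw [hb, zero_smul, add_zero, S.map_smul i (by simpa [hb] using hab), hg]
    · right
      rw [(S.v i).map_add_eq_of_lt_right, S.map_smul i hb, hh]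
      rw [S.map_smul i hb, hh]
      exact (S.map_smul_le i a g).trans_lt (by rw [hg]; simpa using hmn)
  have key (hm : 1 < S.v i (a • g + b • h)) : S.v i f = S.v i (a • g + b • h) := by
    rw [← sub_add_cancel f (a • g + b • h)]
    exact (S.v i).map_add_eq_of_lt_right (hi.trans_lt hm)
  refine ⟨f, fun j hj => ?_, ?_⟩
  · simpa [Pi.single_eq_of_ne hj] using hf j
  · rw [key]
    · exact hv
    · rcases hv with hv | hv <;> rw [hv, ← exp_zero, exp_lt_exp] <;> omega

/-- If `u` has a simple pole at `p` and no other pole, then the functions with poles only at `p`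
are polynomials in `u`. -/
lemma exists_aeval_eq {p : ι} {u : K} (hu : u ∈ S.regularAway p) (hup : S.v p u = exp 1) (N : ℕ)
    {g : K} (hg : g ∈ S.regularAway p) (hgp : S.v p g ≤ exp (N : ℤ)) :
    ∃ q : k[X], q.natDegree ≤ N ∧ aeval u q = g := by
  induction N generalizing g with
  | zero =>
    obtain ⟨c, hc⟩ := S.eq_algebraMap g fun i => by
      by_cases hi : i = p
      · subst hi; simpa using hgp
      · exact hg i hi
    exact ⟨C c, by simp, by simpa using hc⟩
  | succ N ih =>
    obtain ⟨c, hc⟩ := S.exists_sub_smul_le p (f := g) (g := u ^ (N + 1)) (n := N)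
      (by rw [map_pow, hup, ← exp_nsmul]; simp) (by simpa using hgp)
    obtain ⟨q, hq, hqg⟩ := ih
      (sub_mem hg (Subalgebra.smul_mem _ (pow_mem hu (N + 1)) c)) hc
    refine ⟨q + C c * X ^ (N + 1), ?_, ?_⟩
    · refine (natDegree_add_le _ _).trans (max_le (hq.trans N.le_succ) ?_)
      exact natDegree_C_mul_X_pow_le _ _
    · simp [hqg, Algebra.smul_def]

lemma exp_one_lt_iff {n : ℤ} : (1 : ℤᵐ⁰) < exp n ↔ 0 < n := by
  rw [← exp_zero, exp_lt_exp]

lemma exists_exp_eq {x : ℤᵐ⁰} (hx : x ≠ 0) : ∃ n : ℤ, x = exp n := ⟨log x, (exp_log hx).symm⟩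

/-- A function with a single simple pole yields such a function at every place. -/
lemma exists_simple_pole {p : ι} {t : K} (ht : t ∈ S.regularAway p) (htp : S.v p t = exp 1)
    (i : ι) : ∃ s ∈ S.regularAway i, S.v i s = exp 1 := by
  by_cases hip : i = p
  · subst hip; exact ⟨t, ht, htp⟩
  -- Shifting `t` by its value at `i` gives `u` with a zero at `i`. The candidate is `u⁻¹`; its pole
  -- order `e` at `i` must be shown to be 1, and other poles excluded.
  obtain ⟨c, hc⟩ := S.exists_residue i t (ht i hip)
  set u := t - algebraMap k K c with hudef
  have hu : u ∈ S.regularAway p := sub_mem ht (Subalgebra.algebraMap_mem _ c)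
  have hup : S.v p u = exp 1 := by
    rw [← htp]
    apply (S.v p).map_sub_eq_of_lt_left
    exact (S.algebraMap_le_one p c).trans_lt (by rw [htp, exp_one_lt_iff]; exact one_pos)
  have hu0 : u ≠ 0 := by
    intro h
    rw [h, map_zero] at hup
    exact exp_ne_zero hup.symm
  obtain ⟨e, he⟩ := exists_exp_eq (x := S.v i u⁻¹) ((S.v i).ne_zero_iff.2 (inv_ne_zero hu0))
  have he1 : 0 < e := by
    rw [← exp_one_lt_iff, ← he]
    exact ((S.v i).val_lt_one_iff hu0).1 hc
  -- The orders 1 and `e + 1` are both prime to `e`. With `N = e + 1`, the zero of `u ^ N` absorbs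
  -- the pole of `f` at `i`, so `f * u ^ N` is a polynomial in `u` of degree at most `N`, and `f` is
  -- a polynomial in `u⁻¹`.
  obtain ⟨f, hf, hfi⟩ := S.exists_mem_regularAway i (m := 1) (n := e + 1) le_rfl (by omega)
  obtain ⟨N, hN⟩ : ∃ N : ℕ, (N : ℤ) = e + 1 := ⟨(e + 1).toNat, by omega⟩
  have hfle : S.v i f ≤ exp (e + 1) := by
    rcases hfi with h | h <;> rw [h, exp_le_exp]; omega
  have hui : S.v i u = exp (-e) := by
    rw [exp_neg, ← he, map_inv₀, inv_inv]
  obtain ⟨q, hqN, hq⟩ := S.exists_aeval_eq hu hup N (g := f * u ^ N) (fun j hj => by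
      rw [map_mul, map_pow]
      by_cases hji : j = i
      · subst hji
        rw [hui, ← exp_nsmul]
        refine (mul_le_mul_left hfle _).trans ?_
        rw [← exp_add, ← exp_zero, exp_le_exp, nsmul_eq_mul, hN]
        nlinarith
      · exact mul_le_one' (hf j hji) (pow_le_one' (hu j hj) N)) (by
      rw [map_mul, map_pow, hup, ← exp_nsmul, nsmul_eq_mul, mul_one]
      exact mul_le_of_le_one_left' (hf p (Ne.symm hip)))
  have hfw : f = aeval u⁻¹ (reflect N q) := by
    let := invertibleOfNonzero hu0
    have h := eval₂_reflect_mul_pow (algebraMap k K) u N q hqN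
    rw [← aeval_def, ← aeval_def, hq, invOf_eq_inv] at h
    exact (mul_right_cancel₀ (pow_ne_zero N hu0) h).symm
  set w := reflect N q
  have hw0 : w ≠ 0 := by
    intro h
    rw [hfw, h, map_zero, map_zero] at hfi
    rcases hfi with h | h <;> exact exp_ne_zero h.symm
  -- At a pole of `u⁻¹` the leading term of `w` dominates. At `i` this makes `e` divide 1 or `e +
  -- 1`; elsewhere it would give `f` a forbidden pole.
  have hval (j : ι) (hj : 1 < S.v j u⁻¹) : S.v j f = S.v j u⁻¹ ^ w.natDegree := by
    have := S.isTrivialOn j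
    rw [hfw]
    exact valuation_aeval_eq_valuation_X_pow_natDegree_of_one_lt_valuation_X u⁻¹ hj hw0
  have hfi' := hval i (by rw [he, exp_one_lt_iff]; exact he1)
  rw [he, ← exp_nsmul, nsmul_eq_mul] at hfi'
  have hd : (w.natDegree : ℤ) * e = 1 ∨ (w.natDegree : ℤ) * e = e + 1 := by
    rwa [hfi', exp_inj, exp_inj] at hfi
  have hd0 : w.natDegree ≠ 0 := by
    intro h
    rw [h] at hd
    simp at hd
    omega
  have hee : e = 1 := by
    have : e ∣ 1 := by
      rcases hd with h | h
      · exact ⟨_, by rw [← h]; ring⟩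
      · exact ⟨w.natDegree - 1, by linear_combination - h⟩
    exact Int.eq_one_of_dvd_one he1.le this
  refine ⟨u⁻¹, fun j hj => ?_, by rw [he, hee]⟩
  by_contra! hlt
  refine (hf j hj).not_gt ?_
  rw [hval j hlt]
  exact one_lt_pow₀ hlt hd0

/-- On a curve of genus one no function has a single simple pole. -/
lemma map_ne_exp_one {p : ι} {t : K} (ht : t ∈ S.regularAway p) : S.v p t ≠ exp 1 := by
  classical
  intro htp
  choose s hs hsi using S.exists_simple_pole ht htp
  -- Powers of `s i` realise every principal part at `i` without other poles. Summing over the poles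
  -- of a repartition makes it principal up to an integral one, so H¹ would vanish.
  have key (i : ι) (n : ℕ) (g : K) (hg : S.v i g ≤ exp (n : ℤ)) :
      ∃ f ∈ S.regularAway i, S.v i (f - g) ≤ 1 := by
    induction n generalizing g with
    | zero => exact ⟨0, zero_mem _, by simpa using hg⟩
    | succ n ih =>
      obtain ⟨c, hc⟩ := S.exists_sub_smul_le i (f := g) (g := s i ^ (n + 1)) (n := n)
        (by rw [map_pow, hsi, ← exp_nsmul]; simp) (by simpa using hg)
      obtain ⟨f, hf, hfi⟩ := ih _ hc
      refine ⟨f + c • s i ^ (n + 1),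
        add_mem hf (Subalgebra.smul_mem _ (pow_mem (hs i) _) c), ?_⟩
      rwa [show f + c • s i ^ (n + 1) - g = f - (g - c • s i ^ (n + 1)) by ring]
  obtain ⟨r, hr, hrn⟩ := S.exists_nontrivial
  have hex (i : ι) : ∃ f ∈ S.regularAway i, S.v i (f - r i) ≤ 1 := by
    rcases eq_or_ne (r i) 0 with h0 | h0
    · exact ⟨0, zero_mem _, by simp [h0]⟩
    · obtain ⟨n, hn⟩ := exists_exp_eq ((S.v i).ne_zero_iff.2 h0)
      exact key i n.toNat (r i) (by rw [hn, exp_le_exp]; omega)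
  choose f hf hfr using hex
  obtain ⟨j, hj⟩ := hrn (∑ i ∈ hr.toFinset, f i)
  refine hj.not_ge ?_
  by_cases hjr : j ∈ hr.toFinset
  · rw [← Finset.add_sum_erase _ _ hjr, add_sub_right_comm]
    refine (S.v j).map_add_le (hfr j) ((S.v j).map_sum_le fun i hi => ?_)
    exact hf i j (Finset.ne_of_mem_erase hi).symm
  · refine (S.v j).map_sub_le ((S.v j).map_sum_le fun i hi => ?_) (by simpa using hjr)
    exact hf i j (by rintro rfl; exact hjr hi)

lemma exists_eq_algebraMap {p : ι} {f : K} (hf : f ∈ S.regularAway p) (hfp : S.v p f ≤ exp 1) :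
    ∃ c : k, algebraMap k K c = f := by
  have h : S.v p f ≤ exp 0 :=
    le_exp_of_lt_exp_add_one (by simpa using lt_of_le_of_ne hfp (S.map_ne_exp_one hf))
  refine S.eq_algebraMap f fun i => ?_
  by_cases hi : i = p
  · subst hi; simpa using h
  · exact hf i hi

/-- Of the two possible orders 1 and `n`, the first is excluded. -/
lemma exists_pole (p : ι) {n : ℤ} (hn : 2 ≤ n) : ∃ f ∈ S.regularAway p, S.v p f = exp n := by
  obtain ⟨f, hf, h⟩ := S.exists_mem_regularAway p (m := 1) (n := n) le_rfl (by omega)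
  exact ⟨f, hf, h.resolve_left (S.map_ne_exp_one hf)⟩

lemma eq_zero_of_smul_add_eq_zero (p : ι) {c : k} {g h : K} (hgh : S.v p h < S.v p g)
    (heq : c • g + h = 0) : c = 0 := by
  by_contra hc
  have := (S.v p).map_add_eq_of_lt_left (x := c • g) (y := h) (by rwa [S.map_smul p hc])
  rw [heq, map_zero, S.map_smul p hc] at this
  simp [← this] at hgh

/-! ### Weierstrass coordinates and changes of variables -/

/-- Coordinate functions `x` and `y` with poles of order two and three at `p`, and a Weierstrass
equation that they satisfy. -/
structure WeierstrassCoordinates (p : ι) where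
  /-- The function with a double pole at `p`. -/
  x : K
  /-- The function with a triple pole at `p`. -/
  y : K
  /-- The Weierstrass equation. -/
  W : WeierstrassCurve k
  hx : x ∈ S.regularAway p
  hy : y ∈ S.regularAway p
  hxp : S.v p x = exp 2
  hyp : S.v p y = exp 3
  equation : y ^ 2 + algebraMap k K W.a₁ * x * y + algebraMap k K W.a₃ * y =
    x ^ 3 + algebraMap k K W.a₂ * x ^ 2 + algebraMap k K W.a₄ * x + algebraMap k K W.a₆

section Span

variable {S} {p : ι} {x y : K}

/-- Here and in the next two lemmas leading terms are removed one order at a time, by `x * y`, `x ^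
2`, `y`, `x` of orders 5, 4, 3, 2; a pole of order at most 1 leaves a constant. -/
lemma eq_of_le_exp_two (hx : x ∈ S.regularAway p) (hxp : S.v p x = exp 2) {f : K}
    (hf : f ∈ S.regularAway p) (hfp : S.v p f ≤ exp 2) :
    ∃ a b : k, f = algebraMap k K a + algebraMap k K b * x := by
  obtain ⟨b, hb⟩ := S.exists_sub_smul_le p (n := 1) hxp hfp
  obtain ⟨a, ha⟩ := S.exists_eq_algebraMap (sub_mem hf (Subalgebra.smul_mem _ hx b)) hb
  exact ⟨a, b, by rw [ha, Algebra.smul_def]; ring⟩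

lemma eq_of_le_exp_three (hx : x ∈ S.regularAway p) (hxp : S.v p x = exp 2)
    (hy : y ∈ S.regularAway p) (hyp : S.v p y = exp 3) {f : K}
    (hf : f ∈ S.regularAway p) (hfp : S.v p f ≤ exp 3) :
    ∃ a b c : k, f = algebraMap k K a + algebraMap k K b * x + algebraMap k K c * y := by
  obtain ⟨c, hc⟩ := S.exists_sub_smul_le p (n := 2) hyp hfp
  obtain ⟨a, b, h⟩ := eq_of_le_exp_two hx hxp (sub_mem hf (Subalgebra.smul_mem _ hy c)) hc
  exact ⟨a, b, c, by rw [← h, Algebra.smul_def]; ring⟩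

lemma eq_of_le_exp_five (hx : x ∈ S.regularAway p) (hxp : S.v p x = exp 2)
    (hy : y ∈ S.regularAway p) (hyp : S.v p y = exp 3) {f : K}
    (hf : f ∈ S.regularAway p) (hfp : S.v p f ≤ exp 5) :
    ∃ a b c d e : k, f = algebraMap k K a + algebraMap k K b * x + algebraMap k K c * y +
      algebraMap k K d * x ^ 2 + algebraMap k K e * (x * y) := by
  obtain ⟨e, he⟩ := S.exists_sub_smul_le p (n := 4) (g := x * y)
    (by rw [map_mul, hxp, hyp]; rfl) hfp
  have h1 := sub_mem hf (Subalgebra.smul_mem _ (mul_mem hx hy) e)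
  obtain ⟨d, hd⟩ := S.exists_sub_smul_le p (n := 3) (g := x ^ 2)
    (by rw [map_pow, hxp]; rfl) he
  obtain ⟨a, b, c, h⟩ := eq_of_le_exp_three hx hxp hy hyp
    (sub_mem h1 (Subalgebra.smul_mem _ (pow_mem hx 2) d)) hd
  exact ⟨a, b, c, d, e, by rw [← h, Algebra.smul_def, Algebra.smul_def]; ring⟩

end Span

lemma exists_weierstrassCoordinates (p : ι) : Nonempty (S.WeierstrassCoordinates p) := by
  obtain ⟨x, hx, hxp⟩ := S.exists_pole p (n := 2) le_rfl
  obtain ⟨y, hy, hyp⟩ := S.exists_pole p (n := 3) (by norm_num)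
  have hx3 : S.v p (x ^ 3) = exp 6 := by rw [map_pow, hxp]; rfl
  have hy2 : S.v p (y ^ 2) = exp 6 := by rw [map_pow, hyp]; rfl
  -- Both `y ^ 2` and `x ^ 3` have a pole of order 6, so `y ^ 2 - m • x ^ 3` has order at most 5 for
  -- some `m`. Multiplying the resulting relation by `m ^ 2` makes it monic in `m • x` and `m • y`.
  obtain ⟨m, hm⟩ := S.exists_sub_smul_le p (n := 5) (f := y ^ 2) hx3 hy2.le
  have hm0 : m ≠ 0 := by
    rintro rfl
    rw [zero_smul, sub_zero, hy2, exp_le_exp] at hm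
    norm_num at hm
  obtain ⟨a, b, c, d, e, h⟩ := eq_of_le_exp_five hx hxp hy hyp
    (sub_mem (pow_mem hy 2) (Subalgebra.smul_mem _ (pow_mem hx 3) m)) hm
  rw [Algebra.smul_def] at h
  refine ⟨⟨m • x, m • y, ⟨-e, d, -(m * c), m * b, m ^ 2 * a⟩, Subalgebra.smul_mem _ hx m,
    Subalgebra.smul_mem _ hy m, by rw [S.map_smul p hm0, hxp], by rw [S.map_smul p hm0, hyp], ?_⟩⟩
  simp only [Algebra.smul_def, map_neg, map_mul, map_pow]
  linear_combination (algebraMap k K m) ^ 2 * h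

namespace WeierstrassCoordinates

variable {S} {p : ι} (w : S.WeierstrassCoordinates p)

/-- The monomials have distinct pole orders 0, 2, 3, 4, 5, 6 at `p`, so the coefficients vanish one
by one from the top. -/
lemma coefficients_eq_zero {a b c d e f : k}
    (h : algebraMap k K a + algebraMap k K b * w.x + algebraMap k K c * w.y +
      algebraMap k K d * w.x ^ 2 + algebraMap k K e * (w.x * w.y) +
      algebraMap k K f * w.x ^ 3 = 0) :
    a = 0 ∧ b = 0 ∧ c = 0 ∧ d = 0 ∧ e = 0 ∧ f = 0 := by
  have vle (c : k) {g : K} {m : ℤ} (n : ℤ) (hg : S.v p g = exp m) (hmn : m ≤ n) :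
      S.v p (algebraMap k K c * g) ≤ exp n := by
    rw [← Algebra.smul_def]
    exact (S.map_smul_le p c g).trans (by rwa [hg, exp_le_exp])
  have vc (c : k) (n : ℤ) (hn : 0 ≤ n) : S.v p (algebraMap k K c) ≤ exp n :=
    (S.algebraMap_le_one p c).trans (by rwa [← exp_zero, exp_le_exp])
  have hx2 : S.v p (w.x ^ 2) = exp 4 := by rw [map_pow, w.hxp]; rfl
  have hx3 : S.v p (w.x ^ 3) = exp 6 := by rw [map_pow, w.hxp]; rfl
  have hxy : S.v p (w.x * w.y) = exp 5 := by rw [map_mul, w.hxp, w.hyp]; rfl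
  have add {g h : K} {n : ℤ} := (S.v p).map_add_le (x := g) (y := h) (g := exp n)
  have hf : f = 0 := by
    refine S.eq_zero_of_smul_add_eq_zero p (g := w.x ^ 3) (h := _) ?_
      (by rw [Algebra.smul_def, add_comm]; exact h)
    rw [hx3]
    exact (add (n := 5) (add (add (add (vc _ _ (by norm_num)) (vle _ _ w.hxp (by norm_num)))
      (vle _ _ w.hyp (by norm_num))) (vle _ _ hx2 (by norm_num))) (vle _ _ hxy le_rfl)).trans_lt
      (by rw [exp_lt_exp]; norm_num)
  rw [hf, map_zero, zero_mul, add_zero] at h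
  have he : e = 0 := by
    refine S.eq_zero_of_smul_add_eq_zero p (g := w.x * w.y) (h := _) ?_
      (by rw [Algebra.smul_def, add_comm]; exact h)
    rw [hxy]
    exact (add (n := 4) (add (add (vc _ _ (by norm_num)) (vle _ _ w.hxp (by norm_num)))
      (vle _ _ w.hyp (by norm_num))) (vle _ _ hx2 le_rfl)).trans_lt
      (by rw [exp_lt_exp]; norm_num)
  rw [he, map_zero, zero_mul, add_zero] at h
  have hd : d = 0 := by
    refine S.eq_zero_of_smul_add_eq_zero p (g := w.x ^ 2) (h := _) ?_
      (by rw [Algebra.smul_def, add_comm]; exact h)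
    rw [hx2]
    exact (add (n := 3) (add (vc _ _ (by norm_num)) (vle _ _ w.hxp (by norm_num)))
      (vle _ _ w.hyp le_rfl)).trans_lt (by rw [exp_lt_exp]; norm_num)
  rw [hd, map_zero, zero_mul, add_zero] at h
  have hc : c = 0 := by
    refine S.eq_zero_of_smul_add_eq_zero p (g := w.y) (h := _) ?_
      (by rw [Algebra.smul_def, add_comm]; exact h)
    rw [w.hyp]
    exact (add (n := 2) (vc _ _ (by norm_num)) (vle _ _ w.hxp le_rfl)).trans_lt
      (by rw [exp_lt_exp]; norm_num)
  rw [hc, map_zero, zero_mul, add_zero] at h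
  have hb : b = 0 := by
    refine S.eq_zero_of_smul_add_eq_zero p (g := w.x) (h := _) ?_
      (by rw [Algebra.smul_def, add_comm]; exact h)
    rw [w.hxp]
    exact (vc _ 1 (by norm_num)).trans_lt (by rw [exp_lt_exp]; norm_num)
  rw [hb, map_zero, zero_mul, add_zero] at h
  exact ⟨(map_eq_zero _).1 h, hb, hc, hd, he, hf⟩

/-- Every automorphism of the function field that respects the pole orders at `p` acts on the
coordinates by an admissible change of variables that preserves the Weierstrass equation. -/
lemma exists_variableChange (σ : K →ₐ[k] K) (hσ : ∀ f ∈ S.regularAway p, σ f ∈ S.regularAway p)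
    (hσp : ∀ f, S.v p (σ f) = S.v p f) :
    ∃ C : WeierstrassCurve.VariableChange k, C • w.W = w.W ∧
      σ w.x = algebraMap k K (C.u ^ 2 : k) * w.x + algebraMap k K C.r ∧
      σ w.y = algebraMap k K (C.u ^ 3 : k) * w.y + algebraMap k K (C.u ^ 2 * C.s : k) * w.x +
        algebraMap k K C.t := by
  obtain ⟨r, α, hX⟩ := eq_of_le_exp_two w.hx w.hxp (hσ _ w.hx) (by rw [hσp, w.hxp])
  obtain ⟨t, δ, γ, hY⟩ := eq_of_le_exp_three w.hx w.hxp w.hy w.hyp (hσ _ w.hy)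
    (by rw [hσp, w.hyp])
  have hα : α ≠ 0 := by
    rintro rfl
    have h := hσp w.x
    rw [hX, map_zero, zero_mul, add_zero, w.hxp] at h
    have := h ▸ S.algebraMap_le_one p r
    rw [← exp_zero, exp_le_exp] at this
    norm_num at this
  have hE := congrArg σ w.equation
  simp only [map_add, map_mul, map_pow, AlgHom.commutes, hX, hY] at hE
  -- Subtracting `γ ^ 2` times the original equation from its image removes `y ^ 2`; the other
  -- monomials are independent.
  obtain ⟨h6, h4, h3, h2, h1, h0⟩ := w.coefficients_eq_zero
    (a := t ^ 2 + w.W.a₁ * r * t + w.W.a₃ * t - r ^ 3 - w.W.a₂ * r ^ 2 - w.W.a₄ * r - w.W.a₆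
      + γ ^ 2 * w.W.a₆)
    (b := 2 * δ * t + w.W.a₁ * (α * t + r * δ) + w.W.a₃ * δ - 3 * α * r ^ 2
      - 2 * w.W.a₂ * α * r - w.W.a₄ * α + γ ^ 2 * w.W.a₄)
    (c := 2 * γ * t + w.W.a₁ * r * γ + w.W.a₃ * γ - γ ^ 2 * w.W.a₃)
    (d := δ ^ 2 + w.W.a₁ * α * δ - 3 * α ^ 2 * r - w.W.a₂ * α ^ 2 + γ ^ 2 * w.W.a₂)
    (e := 2 * γ * δ + w.W.a₁ * α * γ - γ ^ 2 * w.W.a₁)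
    (f := γ ^ 2 - α ^ 3) (by
      simp only [map_add, map_sub, map_mul, map_pow, map_ofNat]
      linear_combination hE - (algebraMap k K γ) ^ 2 * w.equation)
  have hγ : γ ≠ 0 := by
    rintro rfl
    simp [hα] at h0
  -- The coefficient of `x ^ 3` gives `γ ^ 2 = α ^ 3`, so `u = γ / α` satisfies `α = u ^ 2` and `γ =
  -- u ^ 3`.
  have hu0 : γ / α ≠ 0 := div_ne_zero hγ hα
  obtain ⟨u, hu⟩ : ∃ u : kˣ, (u : k) = γ / α := ⟨Units.mk0 _ hu0, rfl⟩
  have hua : α = (u : k) ^ 2 := by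
    rw [hu]; field_simp; linear_combination -h0
  have hug : γ = (u : k) ^ 3 := by
    rw [hu]; field_simp; linear_combination -h0
  have hun : (u : k) ≠ 0 := u.ne_zero
  have hδ : δ = (u : k) ^ 2 * (δ / u ^ 2) := by field_simp
  refine ⟨⟨u, r, δ / u ^ 2, t⟩, ?_, ?_, ?_⟩
  -- The coefficients of `x * y`, `x ^ 2`, `y`, `x` and 1 are, up to sign, the transformation laws
  -- of `a₁`, `a₂`, `a₃`, `a₄`, `a₆` multiplied by `u ^ 5`, `u ^ 4`, `u ^ 3`, `u ^ 2` and 1.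
  · generalize δ / (u : k) ^ 2 = s at hδ
    subst hua hug hδ
    ext <;> simp only [WeierstrassCurve.variableChange_a₁, WeierstrassCurve.variableChange_a₂,
      WeierstrassCurve.variableChange_a₃, WeierstrassCurve.variableChange_a₄,
      WeierstrassCurve.variableChange_a₆, Units.val_inv_eq_inv_val] <;> field_simp
    · refine mul_left_cancel₀ (pow_ne_zero 5 hun) ?_
      linear_combination h1
    · refine mul_left_cancel₀ (pow_ne_zero 4 hun) ?_
      linear_combination -h2
    · refine mul_left_cancel₀ (pow_ne_zero 3 hun) ?_
      linear_combination h3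
    · refine mul_left_cancel₀ (pow_ne_zero 2 hun) ?_
      linear_combination -h4
    · linear_combination -h6
  · rw [hX, hua]; ring
  · rw [hY, ← hδ, hug]; ring

end WeierstrassCoordinates

end GenusOneFunctionField

/-! ### Singular points and symmetries of Weierstrass equations -/

section Weierstrass

variable {k : Type*} [Field k] (W : WeierstrassCurve k)

/-- If 2 is invertible, the singular point lies over a double root of the two-torsion polynomial,
whose discriminant is a multiple of `Δ`. In characteristic 2 with `a₁ ≠ 0`, the partial derivatives
determine the point and `Δ = 0` puts it on the curve. If also `a₁ = 0`, then `Δ = a₃ ^ 4`, so `a₃ =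
0` and square roots give the point. -/
lemma exists_singular_of_Δ_eq_zero [IsAlgClosed k] (hΔ : W.Δ = 0) :
    ∃ x y : k, y ^ 2 + W.a₁ * x * y + W.a₃ * y = x ^ 3 + W.a₂ * x ^ 2 + W.a₄ * x + W.a₆ ∧
      W.a₁ * y = 3 * x ^ 2 + 2 * W.a₂ * x + W.a₄ ∧ 2 * y + W.a₁ * x + W.a₃ = 0 := by
  by_cases h2 : (2 : k) = 0
  · by_cases h1 : W.a₁ = 0
    · have h3 : W.a₃ = 0 := by
        have : W.a₃ ^ 4 = 0 := by
          rw [WeierstrassCurve.Δ, WeierstrassCurve.b₂, WeierstrassCurve.b₄, WeierstrassCurve.b₆,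
            WeierstrassCurve.b₈, h1] at hΔ
          grind
        exact pow_eq_zero_iff (n := 4) (by norm_num) |>.1 this
      obtain ⟨x, hx⟩ := IsAlgClosed.exists_pow_nat_eq W.a₄ (n := 2) (by norm_num)
      obtain ⟨y, hy⟩ := IsAlgClosed.exists_pow_nat_eq
        (x ^ 3 + W.a₂ * x ^ 2 + W.a₄ * x + W.a₆) (n := 2) (by norm_num)
      refine ⟨x, y, ?_, ?_, ?_⟩
      · rw [h1, h3, hy]; ring
      · rw [h1, ← hx]; linear_combination -(2 * x ^ 2 + W.a₂ * x) * h2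
      · rw [h1, h3, h2]; ring
    · refine ⟨W.a₃ / W.a₁, (3 * (W.a₃ / W.a₁) ^ 2 + 2 * W.a₂ * (W.a₃ / W.a₁) + W.a₄) / W.a₁,
        ?_, ?_, ?_⟩
      · rw [WeierstrassCurve.Δ, WeierstrassCurve.b₂, WeierstrassCurve.b₄, WeierstrassCurve.b₆,
            WeierstrassCurve.b₈] at hΔ
        field_simp
        grind
      · field_simp
      · field_simp
        linear_combination ((3 * (W.a₃ ^ 2) + 2 * W.a₂ * (W.a₃ * W.a₁) + W.a₄ * W.a₁ ^ 2) + W.a₃ * W.a₁ ^ 3) * h2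
  · classical
    have ha : W.twoTorsionPolynomial.a ≠ 0 := by
      rw [WeierstrassCurve.twoTorsionPolynomial]
      exact (show (4 : k) = 2 * 2 by norm_num) ▸ mul_ne_zero h2 h2
    have hd : W.twoTorsionPolynomial.discr = 0 := by
      rw [W.twoTorsionPolynomial_discr, hΔ, mul_zero]
    have hn := (Cubic.discr_ne_zero_iff_roots_nodup (φ := RingHom.id k) ha
      (IsAlgClosed.splits _)).not.1 (not_not.2 hd)
    obtain ⟨x, hx⟩ := Multiset.nodup_iff_count_le_one.not.1 hn |> not_forall.1
    rw [not_le, Cubic.map_roots, Polynomial.map_id, count_roots,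
      one_lt_rootMultiplicity_iff_isRoot (Cubic.ne_zero_of_a_ne_zero ha)] at hx
    obtain ⟨e1, e2⟩ := hx
    simp only [WeierstrassCurve.twoTorsionPolynomial, Cubic.toPoly, WeierstrassCurve.b₂,
      WeierstrassCurve.b₄, WeierstrassCurve.b₆, IsRoot.def, derivative_add, derivative_mul,
      derivative_C, derivative_X_pow, derivative_X, eval_add, eval_mul, eval_C, eval_pow,
      eval_X, zero_mul, zero_add, mul_one, add_zero] at e1 e2
    norm_num at e2
    refine ⟨x, -(W.a₁ * x + W.a₃) / 2, ?_, ?_, ?_⟩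
    · field_simp
      linear_combination -e1
    · field_simp
      refine mul_left_cancel₀ h2 ?_
      linear_combination -e2
    · field_simp
      ring

/-- Each of `r`, `s`, `t` will be a root of such a nonconstant polynomial, with coefficients
depending only on the curve and on parameters already fixed. -/
lemma finite_setOf_quartic_eq_zero (a b c d e : k) (h : ¬ (a = 0 ∧ b = 0 ∧ c = 0 ∧ d = 0)) :
    {x : k | a * x ^ 4 + b * x ^ 3 + c * x ^ 2 + d * x + e = 0}.Finite := by
  classical
  set p : k[X] := C a * X ^ 4 + C b * X ^ 3 + C c * X ^ 2 + C d * X + C e with hp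
  have hp0 : p ≠ 0 := by
    intro h0
    refine h ⟨?_, ?_, ?_, ?_⟩
    · simpa [hp, coeff_X, coeff_C, coeff_X_pow] using congrArg (coeff · 4) h0
    · simpa [hp, coeff_X, coeff_C, coeff_X_pow] using congrArg (coeff · 3) h0
    · simpa [hp, coeff_X, coeff_C, coeff_X_pow] using congrArg (coeff · 2) h0
    · simpa [hp, coeff_X, coeff_C, coeff_X_pow] using congrArg (coeff · 1) h0
  refine p.roots.toFinset.finite_toSet.subset fun x hx => ?_
  rw [Finset.mem_coe, Multiset.mem_toFinset, mem_roots hp0]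
  simpa [hp] using hx

/-- The equations satisfied by an admissible change of variables with parameters `u, r, s, t` that
preserves a Weierstrass equation with nonzero discriminant. -/
structure IsWeierstrassSymmetry (u r s t : k) : Prop where
  h0 : u ^ 12 = 1
  h1 : W.a₁ + 2 * s = u * W.a₁
  h2 : W.a₂ - s * W.a₁ + 3 * r - s ^ 2 = u ^ 2 * W.a₂
  h3 : W.a₃ + r * W.a₁ + 2 * t = u ^ 3 * W.a₃
  h4 : W.a₄ - s * W.a₃ + 2 * r * W.a₂ - (t + r * s) * W.a₁ + 3 * r ^ 2 - 2 * s * t =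
    u ^ 4 * W.a₄
  h6 : W.a₆ + r * W.a₄ + r ^ 2 * W.a₂ + r ^ 3 - t * W.a₃ - t ^ 2 - r * t * W.a₁ = u ^ 6 * W.a₆

variable {W}

/-- The discriminant scales by `u⁻¹ ^ 12`, which forces `u ^ 12 = 1`; the other equations come from
clearing powers of `u`. -/
lemma isWeierstrassSymmetry_of_smul_eq (hΔ : W.Δ ≠ 0) {C : WeierstrassCurve.VariableChange k}
    (hC : C • W = W) : IsWeierstrassSymmetry W C.u C.r C.s C.t where
  h0 := by
    have h := W.variableChange_Δ C
    rw [hC] at h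
    have h' : ((C.u⁻¹ : kˣ) : k) ^ 12 = 1 := by
      refine mul_right_cancel₀ hΔ ?_
      rw [one_mul]; exact h.symm
    rwa [Units.val_inv_eq_inv_val, inv_pow, inv_eq_one] at h'
  h1 := by
    have h := congrArg WeierstrassCurve.a₁ hC
    rw [WeierstrassCurve.variableChange_a₁, Units.val_inv_eq_inv_val,
      inv_mul_eq_iff_eq_mul₀ C.u.ne_zero] at h
    exact h
  h2 := by
    have h := congrArg WeierstrassCurve.a₂ hC
    rw [WeierstrassCurve.variableChange_a₂, Units.val_inv_eq_inv_val, inv_pow,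
      inv_mul_eq_iff_eq_mul₀ (pow_ne_zero _ C.u.ne_zero)] at h
    exact h
  h3 := by
    have h := congrArg WeierstrassCurve.a₃ hC
    rw [WeierstrassCurve.variableChange_a₃, Units.val_inv_eq_inv_val, inv_pow,
      inv_mul_eq_iff_eq_mul₀ (pow_ne_zero _ C.u.ne_zero)] at h
    exact h
  h4 := by
    have h := congrArg WeierstrassCurve.a₄ hC
    rw [WeierstrassCurve.variableChange_a₄, Units.val_inv_eq_inv_val, inv_pow,
      inv_mul_eq_iff_eq_mul₀ (pow_ne_zero _ C.u.ne_zero)] at h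
    exact h
  h6 := by
    have h := congrArg WeierstrassCurve.a₆ hC
    rw [WeierstrassCurve.variableChange_a₆, Units.val_inv_eq_inv_val, inv_pow,
      inv_mul_eq_iff_eq_mul₀ (pow_ne_zero _ C.u.ne_zero)] at h
    exact h

lemma finite_setOf_isWeierstrassSymmetry_t (u r s : k) :
    {t | IsWeierstrassSymmetry W u r s t}.Finite := by
  refine (finite_setOf_quartic_eq_zero 0 0 1 (W.a₃ + r * W.a₁)
    (u ^ 6 * W.a₆ - (W.a₆ + r * W.a₄ + r ^ 2 * W.a₂ + r ^ 3)) (by simp)).subset fun t ht => ?_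
  rw [Set.mem_ofPred_eq]
  linear_combination -ht.h6

lemma finite_setOf_isWeierstrassSymmetry_rs (hΔ : W.Δ ≠ 0) (u : k) :
    {x : k × k | ∃ t, IsWeierstrassSymmetry W u x.1 x.2 t}.Finite := by
  by_cases h2 : (2 : k) = 0
  · by_cases h1 : W.a₁ = 0
    · have h3 : W.a₃ ≠ 0 := by
        intro h3
        refine hΔ ?_
        rw [WeierstrassCurve.Δ, WeierstrassCurve.b₂, WeierstrassCurve.b₄, WeierstrassCurve.b₆,
          WeierstrassCurve.b₈, h1, h3]
        grind
      refine Set.Finite.of_finite_fibers Prod.snd ?_ fun s _ => ?_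
      · refine (finite_setOf_quartic_eq_zero 1 0 0 (-W.a₃)
          ((u ^ 2 * W.a₂ - W.a₂) ^ 2 + W.a₄ - u ^ 4 * W.a₄) (by simp)).subset ?_
        rintro _ ⟨⟨r, s⟩, ⟨t, ht⟩, rfl⟩
        have e2 := ht.h2
        have e4 := ht.h4
        simp only [h1, Set.mem_ofPred_eq] at *
        grind
      · refine ((finite_setOf_quartic_eq_zero 0 0 0 1
          (- (s ^ 2 + (u ^ 2 * W.a₂ - W.a₂))) (by simp)).image (fun r => (r, s))).subset ?_
        rintro ⟨r, s'⟩ ⟨⟨t, ht⟩, rfl : s' = s⟩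
        refine ⟨r, ?_, rfl⟩
        have e2 := ht.h2
        simp only [h1, Set.mem_ofPred_eq] at *
        grind
    -- In characteristic 2 with `a₁ ≠ 0`, `h3` is linear in `r` and `h2` is then quadratic in `s`.
    · refine Set.Finite.of_finite_fibers Prod.fst ?_ fun r _ => ?_
      · refine (finite_setOf_quartic_eq_zero 0 0 0 W.a₁
          (W.a₃ - u ^ 3 * W.a₃) (by simp [h1])).subset ?_
        rintro _ ⟨⟨r, s⟩, ⟨t, ht⟩, rfl⟩
        rw [Set.mem_ofPred_eq]
        linear_combination ht.h3 - t * h2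
      · refine ((finite_setOf_quartic_eq_zero 0 0 1 W.a₁
          (u ^ 2 * W.a₂ - W.a₂ - 3 * r) (by simp)).image (fun s => (r, s))).subset ?_
        rintro ⟨r', s⟩ ⟨⟨t, ht⟩, rfl : r' = r⟩
        refine ⟨s, ?_, rfl⟩
        rw [Set.mem_ofPred_eq]
        linear_combination -ht.h2
  -- If 2 is invertible, `h1` determines `s`. Completing the square in `t` in `h6` and using `h3`
  -- leaves a cubic in `r` with leading coefficient 4.
  · refine Set.Finite.of_finite_fibers Prod.snd ?_ fun s _ => ?_
    · refine (finite_setOf_quartic_eq_zero 0 0 0 2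
          (W.a₁ - u * W.a₁) (by simp [h2])).subset ?_
      rintro _ ⟨⟨r, s⟩, ⟨t, ht⟩, rfl⟩
      rw [Set.mem_ofPred_eq]
      linear_combination ht.h1
    · refine ((finite_setOf_quartic_eq_zero 0 4 (4 * W.a₂ + W.a₁ ^ 2) (4 * W.a₄ + 2 * W.a₁ * W.a₃)
        (4 * W.a₆ * (1 - u ^ 6) - (u ^ 3 * W.a₃ - W.a₃) * (u ^ 3 * W.a₃ + W.a₃))
        ?_).image (fun r => (r, s))).subset ?_
      · rintro ⟨-, h4, -⟩
        exact mul_ne_zero h2 h2 (by rw [← h4]; norm_num)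
      rintro ⟨r, s'⟩ ⟨⟨t, ht⟩, rfl : s' = s⟩
      refine ⟨r, ?_, rfl⟩
      rw [Set.mem_ofPred_eq]
      linear_combination 4 * ht.h6 + (W.a₃ + r * W.a₁ + 2 * t + u ^ 3 * W.a₃) * ht.h3

/-- A Weierstrass curve with nonzero discriminant has only finitely many symmetries. -/
lemma finite_setOf_smul_eq (hΔ : W.Δ ≠ 0) :
    {C : WeierstrassCurve.VariableChange k | C • W = W}.Finite := by
  have hfin : {x : k × (k × k) × k |
      IsWeierstrassSymmetry W x.1 x.2.1.1 x.2.1.2 x.2.2}.Finite := by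
    refine Set.Finite.of_finite_fibers (fun x => x.1) ?_ fun u _ => ?_
    · classical
      refine (nthRoots 12 (1 : k)).toFinset.finite_toSet.subset ?_
      rintro _ ⟨x, hx, rfl⟩
      simpa using hx.h0
    refine Set.Finite.of_finite_fibers (fun x => x.2.1) ?_ ?_
    · refine (finite_setOf_isWeierstrassSymmetry_rs hΔ u).subset ?_
      rintro _ ⟨⟨u', x, t⟩, ⟨hx, rfl : u' = u⟩, rfl⟩
      exact ⟨t, hx⟩
    · rintro ⟨r, s⟩ _
      refine ((finite_setOf_isWeierstrassSymmetry_t (W := W) u r s).image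
        (fun t => (u, (r, s), t))).subset ?_
      rintro ⟨u', x, t⟩ ⟨⟨hx, rfl : u' = u⟩, rfl : x = (r, s)⟩
      exact ⟨t, hx, rfl⟩
  refine Set.Finite.of_injOn (f := fun C => ((C.u : k), (C.r, C.s), C.t))
    (fun C hC => isWeierstrassSymmetry_of_smul_eq hΔ hC) (fun C _ C' _ h => ?_) hfin
  simp only [Prod.mk.injEq] at h
  exact WeierstrassCurve.VariableChange.ext (Units.ext h.1) h.2.1.1 h.2.1.2 h.2.2

end Weierstrass

/-! ### Nonsingularity of the equation and generation by the coordinates -/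

namespace GenusOneFunctionField

variable {k K ι : Type*} [Field k] [Field K] [Algebra k K] {S : GenusOneFunctionField k K ι}

namespace WeierstrassCoordinates

variable {p : ι} (w : S.WeierstrassCoordinates p)

lemma x_sub_algebraMap_ne_zero (c : k) : w.x - algebraMap k K c ≠ 0 := by
  intro h0
  have := w.hxp ▸ sub_eq_zero.1 h0 ▸ S.algebraMap_le_one p c
  rw [← exp_zero, exp_le_exp] at this
  norm_num at this

/-- At a singular point `(a, b)`, the slope `z = (y - b) / (x - a)` has a simple pole at `p` and
satisfies a monic quadratic equation over functions regular elsewhere. It then has no other pole,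
which is impossible in genus one. -/
lemma Δ_ne_zero [IsAlgClosed k] : w.W.Δ ≠ 0 := by
  intro hΔ
  obtain ⟨a, b, h, hX, hY⟩ := exists_singular_of_Δ_eq_zero w.W hΔ
  have hxa := w.x_sub_algebraMap_ne_zero a
  set X := w.x - algebraMap k K a with hXdef
  set z := (w.y - algebraMap k K b) / X with hz
  have heq : z * (z + algebraMap k K w.W.a₁) = X + algebraMap k K (w.W.a₂ + 3 * a) := by
    have h' := congrArg (algebraMap k K) h
    have hX' := congrArg (algebraMap k K) hX
    have hY' := congrArg (algebraMap k K) hY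
    have hw := w.equation
    simp only [map_add, map_mul, map_pow, map_ofNat, map_zero] at h' hX' hY' ⊢
    rw [hz]
    field_simp
    rw [hXdef]
    linear_combination hw - h' - (w.x - algebraMap k K a) * hX' -
      (w.y - algebraMap k K b) * hY'
  have hXp : S.v p X = exp 2 := by
    rw [← w.hxp]
    apply (S.v p).map_sub_eq_of_lt_left
    exact (S.algebraMap_le_one p a).trans_lt (by rw [w.hxp, exp_one_lt_iff]; norm_num)
  have hyb : S.v p (w.y - algebraMap k K b) = exp 3 := by
    rw [← w.hyp]
    apply (S.v p).map_sub_eq_of_lt_left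
    exact (S.algebraMap_le_one p b).trans_lt (by rw [w.hyp, exp_one_lt_iff]; norm_num)
  refine S.map_ne_exp_one (p := p) (t := z) (fun j hj => ?_) (by
    rw [hz, map_div₀, hXp, hyb, ← exp_sub]; norm_num)
  by_contra! hlt
  have hza : S.v j (z + algebraMap k K w.W.a₁) = S.v j z :=
    (S.v j).map_add_eq_of_lt_left ((S.algebraMap_le_one j _).trans_lt hlt)
  have h1 := congrArg (S.v j) heq
  rw [map_mul, hza] at h1
  refine (one_lt_mul'' hlt hlt).not_ge (h1 ▸ ?_)
  exact (S.v j).map_add_le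
    (sub_mem w.hx (Subalgebra.algebraMap_mem (S.regularAway p) a) j hj) (S.algebraMap_le_one j _)

lemma mem_adjoin {f : K} (hf : f ∈ S.regularAway p) : f ∈ Algebra.adjoin k {w.x, w.y} := by
  have hx : w.x ∈ Algebra.adjoin k {w.x, w.y} := Algebra.subset_adjoin (by simp)
  have hy : w.y ∈ Algebra.adjoin k {w.x, w.y} := Algebra.subset_adjoin (by simp)
  have key (n : ℕ) (f : K) (hf : f ∈ S.regularAway p) (hn : S.v p f ≤ exp (n + 1 : ℤ)) :
      f ∈ Algebra.adjoin k {w.x, w.y} := by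
    induction n generalizing f with
    | zero =>
      obtain ⟨c, rfl⟩ := S.exists_eq_algebraMap hf (by simpa using hn)
      exact Subalgebra.algebraMap_mem _ c
    | succ n ih =>
      obtain ⟨g, hg, hgp, hgA⟩ : ∃ g ∈ S.regularAway p, S.v p g = exp (n + 1 + 1 : ℤ) ∧
          g ∈ Algebra.adjoin k {w.x, w.y} := by
        -- Every order at least 2 is attained by `x ^ (i + 1)` or `x ^ i * y`, according to parity.
        obtain ⟨i, hi | hi⟩ := Nat.even_or_odd' n
        · refine ⟨w.x ^ (i + 1), pow_mem w.hx _, ?_, pow_mem hx _⟩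
          rw [map_pow, w.hxp, ← exp_nsmul, exp_inj, nsmul_eq_mul]
          push_cast; omega
        · refine ⟨w.x ^ i * w.y, mul_mem (pow_mem w.hx _) w.hy, ?_, mul_mem (pow_mem hx _) hy⟩
          rw [map_mul, map_pow, w.hxp, w.hyp, ← exp_nsmul, ← exp_add, exp_inj, nsmul_eq_mul]
          omega
      obtain ⟨c, hc⟩ := S.exists_sub_smul_le p hgp (by exact_mod_cast hn)
      have := ih _ (sub_mem hf (Subalgebra.smul_mem _ hg c)) hc
      rw [← sub_add_cancel f (c • g)]
      exact add_mem this (Subalgebra.smul_mem _ hgA c)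
  rcases eq_or_ne f 0 with rfl | h0
  · exact zero_mem _
  · obtain ⟨n, hn⟩ := exists_exp_eq ((S.v p).ne_zero_iff.2 h0)
    exact key n.toNat f hf (by rw [hn, exp_le_exp]; omega)

/-- A power of `x` minus its value at `i` clears the pole of `f` at `i`. Thus `K` is the fraction
field of the ring of functions regular away from `p`. -/
lemma exists_mul_mem (w : S.WeierstrassCoordinates p) (f : K) :
    ∃ b ∈ S.regularAway p, b ≠ 0 ∧ b * f ∈ S.regularAway p := by
  classical
  have key (i : ι) : ∃ b ∈ S.regularAway p, b ≠ 0 ∧ (i ≠ p → S.v i (b * f) ≤ 1) := by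
    by_cases hi : i = p
    · exact ⟨1, one_mem _, one_ne_zero, fun h => absurd hi h⟩
    rcases eq_or_ne f 0 with rfl | h0
    · exact ⟨1, one_mem _, one_ne_zero, by simp⟩
    obtain ⟨n, hn⟩ := exists_exp_eq ((S.v i).ne_zero_iff.2 h0)
    obtain ⟨c, hc⟩ := S.exists_residue i w.x (w.hx i hi)
    refine ⟨(w.x - algebraMap k K c) ^ n.toNat,
      pow_mem (sub_mem w.hx (Subalgebra.algebraMap_mem _ c)) _,
      pow_ne_zero _ (w.x_sub_algebraMap_ne_zero c), fun _ => ?_⟩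
    have hc' : S.v i (w.x - algebraMap k K c) ≤ exp (-1) :=
      le_exp_of_lt_exp_add_one (by simpa using hc)
    rw [map_mul, map_pow, hn]
    calc _ ≤ exp (-1 : ℤ) ^ n.toNat * exp n := mul_le_mul_left (pow_le_pow_left' hc' _) _
      _ ≤ 1 := by
        rw [← exp_nsmul, ← exp_add, ← exp_zero, exp_le_exp, nsmul_eq_mul]
        omega
  choose b hb hb0 hbf using key
  have hfin := S.finite_poles f
  refine ⟨∏ i ∈ hfin.toFinset, b i, prod_mem fun i _ => hb i,
    Finset.prod_ne_zero_iff.2 fun i _ => hb0 i, fun j hj => ?_⟩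
  by_cases hjf : j ∈ hfin.toFinset
  · rw [← Finset.prod_erase_mul _ _ hjf, mul_assoc, map_mul]
    exact mul_le_one' ((S.regularAway p).prod_mem (fun i _ => hb i) j hj) (hbf j hj)
  · rw [map_mul]
    exact mul_le_one' ((S.regularAway p).prod_mem (fun i _ => hb i) j hj) (by simpa using hjf)

lemma algHom_ext {σ τ : K →ₐ[k] K} (hx : σ w.x = τ w.x) (hy : σ w.y = τ w.y) : σ = τ := by
  have hA {a : K} (ha : a ∈ S.regularAway p) : σ a = τ a := by
    have : Algebra.adjoin k {w.x, w.y} ≤ AlgHom.equalizer σ τ :=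
      Algebra.adjoin_le (by rintro _ (rfl | rfl); exacts [hx, hy])
    exact this (w.mem_adjoin ha)
  ext f
  obtain ⟨b, hb, hb0, hbf⟩ := w.exists_mul_mem f
  have h := hA hbf
  rw [map_mul, map_mul, ← hA hb] at h
  exact mul_left_cancel₀ ((map_ne_zero σ).2 hb0) h

end WeierstrassCoordinates

/-- Only finitely many endomorphisms of the function field respect the pole orders at `p`. -/
theorem finite_setOf_algHom [IsAlgClosed k] (S : GenusOneFunctionField k K ι) (p : ι) :
    {σ : K →ₐ[k] K | (∀ f ∈ S.regularAway p, σ f ∈ S.regularAway p) ∧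
      ∀ f, S.v p (σ f) = S.v p f}.Finite := by
  obtain ⟨w⟩ := S.exists_weierstrassCoordinates p
  refine ((finite_setOf_smul_eq w.Δ_ne_zero).biUnion (t := fun C => {σ : K →ₐ[k] K |
    σ w.x = algebraMap k K (C.u ^ 2 : k) * w.x + algebraMap k K C.r ∧
      σ w.y = algebraMap k K (C.u ^ 3 : k) * w.y + algebraMap k K (C.u ^ 2 * C.s : k) * w.x +
        algebraMap k K C.t}) fun C _ => Set.Subsingleton.finite fun σ hσ τ hτ =>
    w.algHom_ext (hσ.1.trans hτ.1.symm) (hσ.2.trans hτ.2.symm)).subset fun σ hσ => ?_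
  obtain ⟨C, hC, h⟩ := w.exists_variableChange σ hσ.1 hσ.2
  exact Set.mem_biUnion hC h

end GenusOneFunctionField

end CurveAction

namespace CurveAction

/-! ### Local rings of a smooth curve at closed points -/

section StandardSmooth

open IsLocalRing TensorProduct

/-- The conormal map is defined on the kernel of the residue map, which is only propositionally the
maximal ideal; a variable `I` allows substitution. -/
lemma exists_cotangentSpace_linearEquiv {P M : Type*} [CommRing P] [IsLocalRing P]
    [AddCommGroup M] [Module P M] {I : Ideal P} (hI : I = maximalIdeal P)
    (e : I.Cotangent →ₗ[P] M) (he : Function.Bijective e) :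
    Nonempty (CotangentSpace P ≃ₗ[P] M) := by
  subst hI
  exact ⟨LinearEquiv.ofBijective e he⟩

/-- A local domain over a field `k` that is a localization of a standard smooth `k`-algebra of
relative dimension one and whose residue field is `k` is a discrete valuation ring. -/
theorem isDiscreteValuationRing_of_isStandardSmooth {k A P : Type*} [Field k] [CommRing A]
    [Algebra k A] [Algebra.IsStandardSmoothOfRelativeDimension 1 k A] [CommRing P] [IsDomain P]
    [IsLocalRing P] [Algebra A P] [Algebra k P] [IsScalarTower k A P] (M : Submonoid A)
    [IsLocalization M P] (hres : Function.Surjective (algebraMap k (ResidueField P))) :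
    IsDiscreteValuationRing P := by
  have hstd : Algebra.IsStandardSmooth k A :=
    Algebra.IsStandardSmoothOfRelativeDimension.isStandardSmooth 1
  have : Algebra.FormallySmooth k A := inferInstance
  have : Algebra.FormallyEtale A P := Algebra.FormallyEtale.of_isLocalization M
  have : Algebra.FormallySmooth k P := Algebra.FormallySmooth.comp k A P
  have : IsNoetherianRing A := Algebra.FiniteType.isNoetherianRing k A
  have : IsNoetherianRing P := IsLocalization.isNoetherianRing M P inferInstance
  have : Nontrivial A := (algebraMap A P).domain_nontrivial
  have hsurj : Function.Surjective (algebraMap P (ResidueField P)) := residue_surjective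
  have hbij : Function.Bijective (algebraMap k (ResidueField P)) :=
    ⟨(algebraMap k (ResidueField P)).injective, hres⟩
  have : Algebra.FormallyEtale k (ResidueField P) :=
    Algebra.FormallyEtale.of_equiv (A := k) (AlgEquiv.ofBijective (Algebra.ofId k _) hbij)
  have hinj := (Algebra.FormallySmooth.kerCotangentToTensor_injective_iff (R := k) hsurj).2
    inferInstance
  have hker : RingHom.ker (algebraMap P (ResidueField P)) = maximalIdeal P := ker_residue
  -- The residue field is étale over `k`, so the conormal map into the base change of `Ω[P⁄k]` is
  -- bijective. The target has dimension 1 because localization preserves the rank of differentials.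
  obtain ⟨e⟩ := exists_cotangentSpace_linearEquiv hker
    (KaehlerDifferential.kerCotangentToTensor k P (ResidueField P)) ⟨hinj, fun x =>
      (KaehlerDifferential.exact_kerCotangentToTensor_mapBaseChange k P _ hsurj x).1
        (Subsingleton.elim _ _)⟩
  rw [← IsLocalRing.finrank_CotangentSpace_eq_one_iff]
  let e1 : CotangentSpace P ≃ₗ[ResidueField P] ResidueField P ⊗[P] Ω[P⁄k] :=
    e.extendScalarsOfSurjective hsurj
  let e2 := KaehlerDifferential.tensorKaehlerEquivOfFormallyEtale k A P
  have hA : Module.finrank A Ω[A⁄k] = 1 := by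
    rw [Module.finrank,
      Algebra.IsStandardSmoothOfRelativeDimension.rank_kaehlerDifferential (R := k) (S := A) 1]
    simp
  have : Module.Free P Ω[P⁄k] := Module.Free.of_equiv e2
  rw [e1.finrank_eq, Module.finrank_baseChange, ← e2.finrank_eq, Module.finrank_baseChange, hA]

end StandardSmooth

section Scalars

variable {k : Type u} [Field k] {X : Scheme.{u}} (f : X ⟶ Spec (.of k))

lemma toSpecΓ_globalScalars : X.toSpecΓ ≫ Spec.map (globalScalars f) = f := by
  rw [globalScalars, Spec.map_comp, ← Category.assoc, ← Scheme.toSpecΓ_naturality,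
    Category.assoc, toSpecΓ_SpecMap_ΓSpecIso_inv, Category.comp_id]

/-- The map from `k` to the local ring of `X` at `x`. -/
noncomputable def stalkScalars (x : X) : CommRingCat.of k ⟶ X.presheaf.stalk x :=
  globalScalars f ≫ X.presheaf.germ ⊤ x (TopologicalSpace.Opens.mem_top x)

/-- By the Nullstellensatz, the residue field at a closed point is `k`. -/
lemma stalkScalars_residue_surjective [IsAlgClosed k] [LocallyOfFiniteType f] {x : X}
    (hx : IsClosed {x}) : Function.Surjective (stalkScalars f x ≫ X.residue x) := by
  have h : stalkScalars f x ≫ X.residue x = (residueFieldIsoBase f x hx).inv := by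
    apply Spec.map_injective
    rw [SpecMap_residueFieldIsoBase_inv, Spec.map_comp, stalkScalars, Spec.map_comp,
      Scheme.fromSpecResidueField, ← Scheme.fromSpecStalk_toSpecΓ]
    simp [toSpecΓ_globalScalars]
  rw [h]
  exact ((ConcreteCategory.isIso_iff_bijective _).1 inferInstance).2

lemma isDiscreteValuationRing_stalk [IsAlgClosed k] [IsIntegral X]
    [SmoothOfRelativeDimension 1 f] {x : X} (hx : IsClosed {x}) :
    IsDiscreteValuationRing (X.presheaf.stalk x) := by
  have : Smooth f := SmoothOfRelativeDimension.smooth 1 f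
  obtain ⟨U, hU, V, hV, hxV, e, hf⟩ :=
    SmoothOfRelativeDimension.exists_isStandardSmoothOfRelativeDimension (n := 1) (f := f) x
  -- The base is a single point.
  obtain rfl : U = ⊤ := by
    ext y
    simpa [Subsingleton.elim y (f x)] using e hxV
  let γ : CommRingCat.of k ⟶ Γ(X, V) := (Scheme.ΓSpecIso (.of k)).inv ≫ f.appLE ⊤ V e
  have hγ : γ.hom.IsStandardSmoothOfRelativeDimension 1 :=
    RingHom.isStandardSmoothOfRelativeDimension_respectsIso.2 _
      (Scheme.ΓSpecIso (.of k)).symm.commRingCatIsoToRingEquiv hf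
  have hγs : γ ≫ X.presheaf.germ V x hxV = stalkScalars f x := by
    simp only [γ, stalkScalars, globalScalars, Scheme.Hom.appLE, Category.assoc,
      X.presheaf.germ_res]
    rfl
  algebraize [γ.hom]
  let := (X.presheaf.germ V x hxV).hom.toAlgebra
  let := (stalkScalars f x).hom.toAlgebra
  have : IsScalarTower k Γ(X, V) (X.presheaf.stalk x) :=
    IsScalarTower.of_algebraMap_eq' (congrArg CommRingCat.Hom.hom hγs.symm)
  have := hV.isLocalization_stalk ⟨x, hxV⟩
  exact isDiscreteValuationRing_of_isStandardSmooth (k := k) (A := Γ(X, V))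
    (hV.primeIdealOf ⟨x, hxV⟩).asIdeal.primeCompl (stalkScalars_residue_surjective f hx)

end Scalars

end CurveAction

namespace CurveAction

/-! ### Closed points as places of the function field -/

section Places

open WithZero IsDedekindDomain

variable {k : Type u} [Field k] {X : Scheme.{u}} [IsIntegral X] (f : X ⟶ Spec (.of k))

noncomputable instance (x : X) : Algebra (X.presheaf.stalk x) (FunField f) :=
  inferInstanceAs (Algebra (X.presheaf.stalk x) X.functionField)

instance (x : X) : IsFractionRing (X.presheaf.stalk x) (FunField f) :=
  inferInstanceAs (IsFractionRing (X.presheaf.stalk x) X.functionField)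

lemma algebraMap_stalkScalars (x : X) (c : k) :
    algebraMap (X.presheaf.stalk x) (FunField f) ((stalkScalars f x).hom c) =
      algebraMap k (FunField f) c := by
  have : Nonempty (⊤ : X.Opens) := ⟨⟨x, TopologicalSpace.Opens.mem_top x⟩⟩
  exact Scheme.algebraMap_germ_eq_germToFunctionField X (TopologicalSpace.Opens.mem_top x)
    ((globalScalars f).hom c)

lemma algebraMap_germ {U : X.Opens} {x : X} (hx : x ∈ U) (hη : genericPoint X ∈ U)
    (s : Γ(X, U)) :
    algebraMap (X.presheaf.stalk x) (FunField f) (X.presheaf.germ U x hx s) =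
      X.presheaf.germ U (genericPoint X) hη s := by
  have : Nonempty U := ⟨⟨x, hx⟩⟩
  exact Scheme.algebraMap_germ_eq_germToFunctionField X hx s

lemma genericPoint_mem {U : X.Opens} {x : X} (hx : x ∈ U) : genericPoint X ∈ U :=
  ((genericPoint_spec X).mem_open_set_iff U.isOpen).mpr ⟨x, trivial, hx⟩

lemma mem_localRing_iff_exists_germ {x : X} {g : FunField f} :
    g ∈ localRing f x ↔ ∃ (U : X.Opens) (_ : x ∈ U) (hη : genericPoint X ∈ U) (s : Γ(X, U)),
      X.presheaf.germ U (genericPoint X) hη s = g := by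
  constructor
  · rintro ⟨a, rfl⟩
    obtain ⟨U, hx, s, rfl⟩ := X.presheaf.exists_germ_eq a
    exact ⟨U, hx, genericPoint_mem hx, s, (algebraMap_germ f hx _ s).symm⟩
  · rintro ⟨U, hx, hη, s, rfl⟩
    exact ⟨X.presheaf.germ U x hx s, algebraMap_germ f hx hη s⟩

section DVR

variable (x : X) [IsDiscreteValuationRing (X.presheaf.stalk x)]

/-- The discrete valuation on the function field attached to a point whose local ring is a
discrete valuation ring. -/
noncomputable def pointValuation : Valuation (FunField f) ℤᵐ⁰ :=
  (IsDiscreteValuationRing.maximalIdeal (X.presheaf.stalk x)).valuation (FunField f)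

lemma pointValuation_le_one_iff {g : FunField f} :
    pointValuation f x g ≤ 1 ↔ g ∈ localRing f x :=
  ⟨fun h => IsDiscreteValuationRing.exists_lift_of_le_one (A := X.presheaf.stalk x)
    (K := FunField f) h, by
    rintro ⟨a, rfl⟩
    exact HeightOneSpectrum.valuation_le_one _ a⟩

lemma pointValuation_algebraMap {c : k} (hc : c ≠ 0) :
    pointValuation f x (algebraMap k (FunField f) c) = 1 := by
  refine le_antisymm ?_ ?_
  · rw [← algebraMap_stalkScalars f x]
    exact HeightOneSpectrum.valuation_le_one _ _
  · rw [Valuation.one_le_val_iff _ ((map_ne_zero _).2 hc), ← map_inv₀,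
      ← algebraMap_stalkScalars f x]
    exact HeightOneSpectrum.valuation_le_one _ _

lemma exists_pointValuation_eq_exp (n : ℤ) : ∃ g, pointValuation f x g = exp n := by
  obtain ⟨π, hπ⟩ := (IsDiscreteValuationRing.maximalIdeal
    (X.presheaf.stalk x)).valuation_exists_uniformizer (FunField f)
  refine ⟨π ^ (-n), ?_⟩
  rw [map_zpow₀, pointValuation, hπ, ← exp_zsmul]
  simp

lemma exists_pointValuation_sub_lt [IsAlgClosed k] [LocallyOfFiniteType f] (hx : IsClosed {x})
    {g : FunField f} (hg : pointValuation f x g ≤ 1) :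
    ∃ c : k, pointValuation f x (g - algebraMap k (FunField f) c) < 1 := by
  obtain ⟨a, rfl⟩ := (pointValuation_le_one_iff f x).1 hg
  obtain ⟨c, hc⟩ := stalkScalars_residue_surjective f hx (X.residue x a)
  refine ⟨c, ?_⟩
  have hmem : a - (stalkScalars f x).hom c ∈
      IsLocalRing.maximalIdeal (X.presheaf.stalk x) := by
    rw [← IsLocalRing.residue_eq_zero_iff, map_sub, sub_eq_zero]
    exact hc.symm
  rw [← algebraMap_stalkScalars f x]
  change pointValuation f x (algebraMap (X.presheaf.stalk x) (FunField f) a -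
    algebraMap (X.presheaf.stalk x) (FunField f) ((stalkScalars f x).hom c)) < 1
  rw [← map_sub]
  exact (HeightOneSpectrum.valuation_lt_one_iff_mem _ _).2 hmem

end DVR

/-- In a Noetherian integral scheme whose local rings at the closed points are discrete valuation
rings, a nonempty open set contains all but finitely many closed points. -/
lemma finite_closedPoints_diff [TopologicalSpace.NoetherianSpace X]
    (hX : ∀ x ∈ closedPoints X, IsDiscreteValuationRing (X.presheaf.stalk x)) {U : X.Opens}
    (hU : genericPoint X ∈ U) : (closedPoints X \ U).Finite := by
  obtain ⟨T, hT, hTc, hTi, hTU⟩ :=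
    TopologicalSpace.NoetherianSpace.exists_finite_set_isClosed_irreducible
      (isClosed_compl_iff.2 U.isOpen)
  refine (hT.biUnion (t := fun Z => closedPoints X ∩ Z) fun Z hZ => ?_).subset ?_
  -- The generic point of `Z` specializes to `x`, so it is a prime of a discrete valuation ring. The
  -- zero prime would put the generic point of `X` outside `U`; hence it is the maximal ideal and `Z
  -- = {x}`.
  · have key (x : X) (hx : x ∈ closedPoints X ∩ Z) : Z = {x} := by
      have := hX x hx.1
      obtain ⟨z, hz⟩ := QuasiSober.sober (hTi Z hZ) (hTc Z hZ)
      have hzx : z ⤳ x := hz.specializes hx.2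
      obtain ⟨q, rfl⟩ : z ∈ Set.range (X.fromSpecStalk x) := by
        rw [Scheme.range_fromSpecStalk]; exact hzx
      have hgx : genericPoint X ∈ Set.range (X.fromSpecStalk x) := by
        rw [Scheme.range_fromSpecStalk]; exact genericPoint_specializes x
      obtain ⟨q', hq'⟩ := hgx
      by_cases hq : q.asIdeal = ⊥
      · have hqq : q ⤳ q' := by
          refine (PrimeSpectrum.le_iff_specializes q q').1 ?_
          change q.asIdeal ≤ q'.asIdeal
          rw [hq]; exact bot_le
        have h1 : X.fromSpecStalk x q ⤳ genericPoint X :=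
          hq' ▸ hqq.map (X.fromSpecStalk x).continuous
        have h2 : genericPoint X ∈ Z := h1.mem_closed (hTc Z hZ) hz.mem
        have h3 : genericPoint X ∈ ((U : Set X)ᶜ) := by
          rw [hTU]; exact ⟨Z, hZ, h2⟩
        exact absurd hU h3
      · have hqm : q = IsLocalRing.closedPoint (X.presheaf.stalk x) := by
          refine PrimeSpectrum.ext ?_
          exact IsLocalRing.eq_maximalIdeal (q.isPrime.isMaximal hq)
        rw [hqm] at hz
        have := hz.def
        rw [Scheme.fromSpecStalk_closedPoint, IsClosed.closure_eq hx.1] at this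
        exact this.symm
    refine Set.Subsingleton.finite fun x hx y hy => ?_
    have := key x hx ▸ hy.2
    exact this.symm
  · rintro x ⟨hx, hxU⟩
    have : x ∈ ⋃₀ T := hTU ▸ hxU
    obtain ⟨Z, hZ, hxZ⟩ := this
    exact Set.mem_biUnion hZ ⟨hx, hxZ⟩

/-- A rational function that is regular at all closed points is a global section. -/
lemma exists_germ_top_eq [CompactSpace X] {g : FunField f}
    (hg : ∀ x ∈ closedPoints X, g ∈ localRing f x) :
    ∃ s : Γ(X, ⊤), X.presheaf.germ ⊤ (genericPoint X) (TopologicalSpace.Opens.mem_top _) s = g := by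
  simp only [mem_localRing_iff_exists_germ] at hg
  choose U hxU hη s hs using fun x : closedPoints X => hg x.1 x.2
  -- By quasi-compactness a nonempty closed complement would contain a closed point.
  have hcov : (⊤ : X.Opens) ≤ ⨆ x, U x := by
    by_contra h
    have hne : ((↑(⨆ x, U x) : Set X)ᶜ).Nonempty := by
      rw [Set.nonempty_compl]
      intro h'
      exact h fun y _ => h'.ge (Set.mem_univ y)
    obtain ⟨x, hx, hxc⟩ := IsClosed.exists_closed_singleton
      (isClosed_compl_iff.2 (⨆ x, U x).isOpen) hne
    exact hx (TopologicalSpace.Opens.mem_iSup.2 ⟨⟨x, hxc⟩, hxU _⟩)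
  obtain ⟨t, ht, -⟩ := X.sheaf.existsUnique_gluing' U ⊤ (fun x => homOfLE le_top) hcov s
    (fun x y => by
      have hmem : genericPoint X ∈ U x ⊓ U y := ⟨hη x, hη y⟩
      refine germ_injective_of_isIntegral X (genericPoint X) hmem ?_
      exact (X.presheaf.germ_res_apply (TopologicalSpace.Opens.infLELeft _ _) _ hmem (s x)).trans
        ((hs x).trans ((hs y).symm.trans (X.presheaf.germ_res_apply
          (TopologicalSpace.Opens.infLERight _ _) _ hmem (s y)).symm)))
  obtain ⟨x⟩ : Nonempty (closedPoints X) := by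
    obtain ⟨x, -, hx⟩ := IsClosed.exists_closed_singleton (X := X) isClosed_univ Set.univ_nonempty
    exact ⟨⟨x, hx⟩⟩
  refine ⟨t, ?_⟩
  rw [← hs x, ← ht x]
  exact (X.presheaf.germ_res_apply (homOfLE le_top) _ (hη x) t).symm

/-- By properness the global sections are integral over the algebraically closed field `k`, so they
are constants. -/
lemma exists_algebraMap_eq [IsAlgClosed k] [IsProper f] {g : FunField f}
    (hg : ∀ x ∈ closedPoints X, g ∈ localRing f x) : ∃ c : k, algebraMap k (FunField f) c = g := by
  have : CompactSpace X := (quasiCompact_iff_compactSpace f).mp inferInstance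
  obtain ⟨s, hs⟩ := exists_germ_top_eq f hg
  have hint : (globalScalars f).hom.IsIntegral :=
    RingHom.isIntegral_respectsIso.2 _ (Scheme.ΓSpecIso (.of k)).symm.commRingCatIsoToRingEquiv
      (isIntegral_appTop_of_universallyClosed f)
  obtain ⟨c, rfl⟩ := (IsAlgClosed.ringHom_bijective_of_isIntegral _ hint).2 s
  exact ⟨c, hs⟩

lemma exists_dependent_of_finrank_eq_one {V : Type*} [AddCommGroup V] [Module k V]
    (h : Module.finrank k V = 1) (r s : V) : ∃ a b : k, (a ≠ 0 ∨ b ≠ 0) ∧ a • r + b • s = 0 := by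
  obtain ⟨v, -, hv⟩ := finrank_eq_one_iff'.1 h
  obtain ⟨c, rfl⟩ := hv r
  obtain ⟨d, rfl⟩ := hv s
  by_cases hd : d = 0
  · exact ⟨0, 1, by simp, by simp [hd]⟩
  · exact ⟨d, -c, Or.inl hd, by rw [smul_smul, smul_smul, ← add_smul]; ring_nf; simp⟩

lemma mk_eq_zero_iff (r : repartitions f) :
    (Submodule.Quotient.mk r : H1 f) = 0 ↔
      ∃ g : FunField f, ∀ x : closedPoints X, g - r.1 x ∈ localRing f x := by
  rw [Submodule.Quotient.mk_eq_zero, Submodule.mem_comap, Submodule.mem_sup]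
  constructor
  · rintro ⟨i, hi, p, ⟨g, rfl⟩, h⟩
    refine ⟨g, fun x => ?_⟩
    have hx : i x + g = r.1 x := congrFun h x
    rw [← hx, show g - (i x + g) = -i x by ring]
    exact neg_mem (hi x trivial)
  · rintro ⟨g, hg⟩
    refine ⟨fun x => r.1 x - g, fun x _ => ?_, fun _ => g, ⟨g, rfl⟩, ?_⟩
    · have := neg_mem (hg x)
      rwa [neg_sub] at this
    · funext x
      exact sub_add_cancel _ _

/-- The valuations attached to the closed points of a smooth proper curve of genus one. -/
noncomputable def genusOneFunctionField [IsAlgClosed k] [IsProper f] [SmoothOfRelativeDimension 1 f]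
    (hgenus : genus f = 1) : GenusOneFunctionField k (FunField f) (closedPoints X) :=
  have hX (x : closedPoints X) : IsDiscreteValuationRing (X.presheaf.stalk x.1) :=
    isDiscreteValuationRing_stalk f x.2
  have hfin (g : FunField f) : {x : closedPoints X | ¬ g ∈ localRing f x.1}.Finite := by
    have : CompactSpace X := (quasiCompact_iff_compactSpace f).mp inferInstance
    have : IsNoetherian X := { __ := LocallyOfFiniteType.isLocallyNoetherian f }
    obtain ⟨U, hU, s, hs⟩ := X.presheaf.exists_germ_eq (x := genericPoint X) g
    refine ((finite_closedPoints_diff (fun x hx => hX ⟨x, hx⟩) hU).preimage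
      Subtype.val_injective.injOn).subset fun x hx => ⟨x.2, fun hxU => hx ?_⟩
    exact (mem_localRing_iff_exists_germ f).2 ⟨U, hxU, hU, s, hs⟩
  { v := fun x => pointValuation f x.1
    map_algebraMap := fun x c hc => pointValuation_algebraMap f x.1 hc
    exists_residue := fun x g hg => exists_pointValuation_sub_lt f x.1 x.2 hg
    exists_exp := fun x n => exists_pointValuation_eq_exp f x.1 n
    finite_poles := fun g => by
      simpa only [← not_le, pointValuation_le_one_iff] using hfin g
    eq_algebraMap := fun g hg => exists_algebraMap_eq f fun x hx =>
      have := hX ⟨x, hx⟩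
      (pointValuation_le_one_iff f x).1 (hg ⟨x, hx⟩)
    exists_dependent := fun r s hr hs => by
      simp only [← not_le, pointValuation_le_one_iff] at hr hs ⊢
      obtain ⟨a, b, hab, h⟩ := exists_dependent_of_finrank_eq_one hgenus
        (Submodule.Quotient.mk ⟨r, hr⟩) (Submodule.Quotient.mk ⟨s, hs⟩)
      let r' : repartitions f := ⟨r, hr⟩
      let s' : repartitions f := ⟨s, hs⟩
      obtain ⟨g, hg⟩ := (mk_eq_zero_iff f (a • r' + b • s')).1 h
      exact ⟨a, b, hab, g, hg⟩
    exists_nontrivial := by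
      have : Nontrivial (H1 f) := Module.nontrivial_of_finrank_pos (R := k)
        (hgenus.symm ▸ one_pos : 0 < genus f)
      obtain ⟨v, hv⟩ := exists_ne (0 : H1 f)
      obtain ⟨r, rfl⟩ := Submodule.Quotient.mk_surjective _ v
      refine ⟨r.1, ?_, ?_⟩
      · simp only [← not_le, pointValuation_le_one_iff]
        exact r.2
      · intro g
        by_contra! h
        exact hv ((mk_eq_zero_iff f r).2 ⟨g, fun x => (pointValuation_le_one_iff f x.1).1 (h x)⟩) }

end Places

end CurveAction

namespace CurveAction

/-! ### Automorphisms acting on rational functions -/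

section Valuation

open WithZero

/-- A ring automorphism that preserves the valuation ring of a normalized discrete valuation
preserves the valuation. -/
lemma valuation_apply_eq_of_le_one_iff {K : Type*} [Field K] (v : Valuation K ℤᵐ⁰)
    (hv : ∃ π, v π = exp (-1)) (σ τ : K →+* K) (hστ : ∀ g, σ (τ g) = g)
    (hσ : ∀ g, v g ≤ 1 → v (σ g) ≤ 1) (hτ : ∀ g, v g ≤ 1 → v (τ g) ≤ 1) (g : K) :
    v (σ g) = v g := by
  obtain ⟨π, hπ⟩ := hv
  have hπ0 : π ≠ 0 := by
    rintro rfl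
    exact exp_ne_zero (hπ.symm.trans (map_zero _))
  have hπ1 : v π ≤ 1 := by rw [hπ, ← exp_zero, exp_le_exp]; norm_num
  -- If `v g = exp n`, then `g * π ^ n` is a unit and `φ` keeps it one, so `φ` multiplies all orders
  -- by that of `φ π`. For `σ` and `τ` these factors are nonnegative integers with product 1.
  have key (φ : K →+* K) (hφ : ∀ g, v g ≤ 1 → v (φ g) ≤ 1) :
      ∃ m : ℤ, 0 ≤ m ∧ ∀ g (n : ℤ), v g = exp n → v (φ g) = exp (m * n) := by
    obtain ⟨m, hm⟩ := GenusOneFunctionField.exists_exp_eq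
      (v.ne_zero_iff.2 ((map_ne_zero φ).2 hπ0))
    refine ⟨-m, ?_, fun g n hg => ?_⟩
    · have := hφ π hπ1
      rw [hm, ← exp_zero, exp_le_exp] at this
      omega
    · have hu : v (g * π ^ n) = 1 := by
        rw [map_mul, map_zpow₀, hg, hπ, ← exp_zsmul, ← exp_add]
        simp
      have hu' : v (φ (g * π ^ n)) = 1 := by
        refine le_antisymm (hφ _ hu.le) ?_
        have h0 : g * π ^ n ≠ 0 := v.ne_zero_iff.1 (by rw [hu]; exact one_ne_zero)
        rw [v.one_le_val_iff ((map_ne_zero φ).2 h0), ← map_inv₀]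
        exact hφ _ (by rw [map_inv₀, hu, inv_one])
      rw [map_mul, map_mul, map_zpow₀, map_zpow₀, hm, ← exp_zsmul] at hu'
      rw [eq_comm, ← inv_eq_of_mul_eq_one_left hu', ← exp_neg]
      congr 1
      simp [mul_comm]
  obtain ⟨m, hm, hm'⟩ := key σ hσ
  obtain ⟨n, hn, hn'⟩ := key τ hτ
  have h1 := hm' _ _ (hn' π _ hπ)
  rw [hστ, hπ, exp_inj] at h1
  have hm1 : m = 1 := Int.eq_one_of_mul_eq_one_right hm (by linarith : m * n = 1)
  rcases eq_or_ne g 0 with rfl | hg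
  · simp
  · obtain ⟨l, hl⟩ := GenusOneFunctionField.exists_exp_eq (v.ne_zero_iff.2 hg)
    rw [hm' g l hl, hm1, one_mul, hl]

end Valuation

section Pullback

variable {k : Type u} [Field k] {X : Scheme.{u}} [IsIntegral X] (f : X ⟶ Spec (.of k))

lemma genericPoint_specializes_apply (φ : X ⟶ X) [IsIso φ] :
    φ (genericPoint X) ⤳ genericPoint X :=
  specializes_of_eq (genericPoint_eq_of_isOpenImmersion φ)

/-- Pullback of rational functions along an automorphism. -/
noncomputable def pullbackMap (φ : X ⟶ X) [IsIso φ] : X.functionField ⟶ X.functionField :=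
  X.presheaf.stalkSpecializes (genericPoint_specializes_apply φ) ≫ φ.stalkMap (genericPoint X)

/-- This square determines `pullbackMap φ`; contravariant functoriality and faithfulness are deduced
from it. -/
lemma SpecMap_pullbackMap (φ : X ⟶ X) [IsIso φ] :
    Spec.map (pullbackMap φ) ≫ X.fromSpecStalk (genericPoint X) =
      X.fromSpecStalk (genericPoint X) ≫ φ := by
  rw [pullbackMap, Spec.map_comp, Category.assoc, Scheme.SpecMap_stalkSpecializes_fromSpecStalk,
    Scheme.SpecMap_stalkMap_fromSpecStalk]

lemma pullbackMap_comp_eq_id {φ ψ : X ⟶ X} [IsIso φ] [IsIso ψ] (h : ψ ≫ φ = 𝟙 X) :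
    pullbackMap φ ≫ pullbackMap ψ = 𝟙 _ := by
  apply Spec.map_injective
  rw [← cancel_mono (X.fromSpecStalk (genericPoint X)), Spec.map_comp, Category.assoc,
    SpecMap_pullbackMap, reassoc_of% (SpecMap_pullbackMap ψ), h]
  simp

lemma pullbackMap_germ (φ : X ⟶ X) [IsIso φ] {U : X.Opens} (hη : genericPoint X ∈ U)
    (hη' : genericPoint X ∈ φ ⁻¹ᵁ U) (s : Γ(X, U)) :
    pullbackMap φ (X.presheaf.germ U (genericPoint X) hη s) =
      X.presheaf.germ (φ ⁻¹ᵁ U) (genericPoint X) hη' (φ.app U s) := by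
  have : X.presheaf.germ U (genericPoint X) hη ≫ pullbackMap φ =
      φ.app U ≫ X.presheaf.germ (φ ⁻¹ᵁ U) (genericPoint X) hη' := by
    rw [pullbackMap, X.presheaf.germ_stalkSpecializes_assoc, Scheme.Hom.germ_stalkMap]
  exact ConcreteCategory.congr_hom this s

/-- Two automorphisms over `k` that induce the same map on rational functions are equal. -/
lemma eq_of_pullbackMap_eq [IsSeparated f] {φ ψ : X ⟶ X} [IsIso φ] [IsIso ψ] (hφ : φ ≫ f = f)
    (hψ : ψ ≫ f = f) (h : pullbackMap φ = pullbackMap ψ) : φ = ψ := by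
  have hdom : IsDominant (X.fromSpecStalk (genericPoint X)) := by
    refine ⟨fun y => ?_⟩
    refine (genericPoint_specializes y).mem_closed isClosed_closure (subset_closure ?_)
    exact ⟨_, Scheme.fromSpecStalk_closedPoint⟩
  refine ext_of_isDominant_of_isSeparated f (hφ.trans hψ.symm)
    (X.fromSpecStalk (genericPoint X)) ?_
  rw [← SpecMap_pullbackMap, h, SpecMap_pullbackMap]

/-- Pullback of rational functions along an automorphism over `k`, as a map of `k`-algebras. -/
noncomputable def pullbackAlgHom (φ : X ⟶ X) [IsIso φ] (hφ : φ ≫ f = f) :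
    FunField f →ₐ[k] FunField f where
  __ := ((pullbackMap φ).hom : X.functionField →+* X.functionField)
  commutes' c := by
    change pullbackMap φ (X.presheaf.germ ⊤ (genericPoint X) _ (globalScalars f c)) =
      X.presheaf.germ ⊤ (genericPoint X) _ (globalScalars f c)
    rw [pullbackMap_germ φ _ (TopologicalSpace.Opens.mem_top _)]
    have h : globalScalars f ≫ φ.appTop = globalScalars f := by
      rw [globalScalars, Category.assoc, ← Scheme.Hom.comp_appTop, hφ]
    have := ConcreteCategory.congr_hom h c
    exact congrArg _ this

lemma pullbackAlgHom_mem_localRing (φ : X ⟶ X) [IsIso φ] (hφ : φ ≫ f = f) {x : X}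
    {g : FunField f} (hg : g ∈ localRing f (φ x)) : pullbackAlgHom f φ hφ g ∈ localRing f x := by
  obtain ⟨U, hU, hη, s, rfl⟩ := (mem_localRing_iff_exists_germ f).1 hg
  have hx : x ∈ φ ⁻¹ᵁ U := hU
  exact (mem_localRing_iff_exists_germ f).2 ⟨φ ⁻¹ᵁ U, hx, genericPoint_mem hx, φ.app U s,
    (pullbackMap_germ φ hη (genericPoint_mem hx) s).symm⟩

end Pullback

instance {k : Type u} [Field k] {X : Scheme.{u}} (f : X ⟶ Spec (.of k)) (g : AutOver f) :
    IsIso g.hom.left :=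
  ((Over.forget _).mapIso g).isIso_hom

section Action

variable {k : Type u} [Field k] {X : Scheme.{u}} (f : X ⟶ Spec (.of k))

lemma smul_mem_closedPoints (g : AutOver f) {y : X} (hy : y ∈ closedPoints X) :
    g • y ∈ closedPoints X := by
  have := g.hom.left.homeomorph.isClosedMap _ hy
  rw [Set.image_singleton] at this
  exact this

/-- The stabilizers of `x` and `g • x` in `H` are conjugate. -/
lemma smul_mem_stabilizedLocus {H : Subgroup (AutOver f)} {g : AutOver f} (hg : g ∈ H) {x : X}
    (hx : x ∈ stabilizedLocus f H) : g • x ∈ stabilizedLocus f H := by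
  refine ⟨smul_mem_closedPoints f g hx.1, fun h => hx.2 ?_⟩
  have := MulAction.stabilizer_smul_eq_stabilizer_map_conj (⟨g, hg⟩ : H) x
  rw [show (⟨g, hg⟩ : H) • x = g • x from rfl, h] at this
  exact (Subgroup.map_eq_bot_iff_of_injective _ (MulEquiv.injective _)).1 this.symm

/-- The action of an automorphism on the function field. -/
noncomputable def autPullback [IsIntegral X] (g : AutOver f) : FunField f →ₐ[k] FunField f :=
  pullbackAlgHom f g.hom.left (Over.w g.hom)

lemma autPullback_autPullback_inv [IsIntegral X] (g : AutOver f) (a : FunField f) :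
    autPullback f g (autPullback f g⁻¹ a) = a := by
  have h : g.hom.left ≫ (g⁻¹).hom.left = 𝟙 X := by
    rw [← Over.comp_left]
    exact congrArg (fun φ : AutOver f => φ.hom.left) (inv_mul_cancel g)
  exact ConcreteCategory.congr_hom (pullbackMap_comp_eq_id (X := X) (φ := (g⁻¹).hom.left)
    (ψ := g.hom.left) h) a

lemma autPullback_injective [IsIntegral X] [IsSeparated f] :
    Function.Injective (autPullback f) := by
  intro g h hgh
  refine Iso.ext (Over.OverMorphism.ext ?_)
  refine eq_of_pullbackMap_eq f (Over.w g.hom) (Over.w h.hom) ?_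
  ext a
  exact DFunLike.congr_fun hgh a

end Action

/-! ### Finiteness of point stabilizers and of group actions -/

section Stabilizer

variable {k : Type u} [Field k] [IsAlgClosed k] {X : Scheme.{u}} [IsIntegral X]
  (f : X ⟶ Spec (.of k))

/-- An automorphism fixing `x` permutes the other closed points, so its pullback preserves
regularity away from `x`. Together with its inverse it preserves the valuation ring at `x`, hence
the pole orders there. -/
lemma finite_setOf_smul_eq_self_of_valuations [IsSeparated f]
    (S : GenusOneFunctionField k (FunField f) (closedPoints X))
    (hle : ∀ y a, S.v y a ≤ 1 ↔ a ∈ localRing f y.1) (x : closedPoints X) :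
    {g : AutOver f | g • x.1 = x.1}.Finite := by
  have hσ (g : AutOver f) (y z : closedPoints X) (hyz : g • y.1 = z.1) (a : FunField f)
      (ha : S.v z a ≤ 1) : S.v y (autPullback f g a) ≤ 1 := by
    rw [hle, ← hyz] at ha
    exact (hle _ _).2 (pullbackAlgHom_mem_localRing f g.hom.left (Over.w g.hom) ha)
  refine Set.Finite.of_injOn (f := autPullback f) (fun g hg => ?_)
    (autPullback_injective f).injOn (S.finite_setOf_algHom x)
  refine ⟨fun a ha y hy => ?_, ?_⟩
  · let z : closedPoints X := ⟨g • y.1, smul_mem_closedPoints f g y.2⟩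
    refine hσ g y z rfl a (ha z fun h => hy ?_)
    have h' : g • y.1 = x.1 := congrArg Subtype.val h
    exact Subtype.ext (MulAction.injective g (h'.trans hg.symm))
  · exact valuation_apply_eq_of_le_one_iff (S.v x) (S.exists_exp _ _) (autPullback f g).toRingHom
      (autPullback f g⁻¹).toRingHom (autPullback_autPullback_inv f g) (hσ g x x hg)
      (hσ g⁻¹ x x (inv_smul_eq_iff.2 hg.symm))

variable [IsProper f] [SmoothOfRelativeDimension 1 f]

/-- The automorphisms of a curve of genus one that fix a given closed point are finite in
number. -/
theorem finite_setOf_smul_eq_self (hgenus : genus f = 1) {x : X} (hx : x ∈ closedPoints X) :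
    {g : AutOver f | g • x = x}.Finite :=
  finite_setOf_smul_eq_self_of_valuations f (genusOneFunctionField f hgenus) (fun y _ =>
    have := isDiscreteValuationRing_stalk f y.2
    pointValuation_le_one_iff f y.1) ⟨x, hx⟩

/-- If nonempty, this set is a coset of the stabilizer of `x`. -/
lemma finite_setOf_smul_eq_point (hgenus : genus f = 1) {x : X} (hx : x ∈ closedPoints X) (y : X) :
    {g : AutOver f | g • x = y}.Finite := by
  rcases Set.eq_empty_or_nonempty {g : AutOver f | g • x = y} with h | ⟨g₀, hg₀⟩
  · rw [h]; exact Set.finite_empty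
  · refine Set.Finite.of_injOn (f := fun g => g₀⁻¹ * g) (fun g hg => ?_)
      (mul_right_injective _).injOn (finite_setOf_smul_eq_self f hgenus hx)
    change (g₀⁻¹ * g) • x = x
    rw [mul_smul, (hg : g • x = y), inv_smul_eq_iff]
    exact hg₀.symm

end Stabilizer

end CurveAction

theorem mainTheorem9 {k : Type u} [Field k] [IsAlgClosed k] {X : Scheme.{u}}
    (f : X ⟶ Spec (.of k)) [IsIntegral X] [IsProper f] [SmoothOfRelativeDimension 1 f]
    (hgenus : CurveAction.genus f = 1) (S : Set X) (hS : S.Finite) (hSc : S ⊆ closedPoints X) :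
    {H : Subgroup (CurveAction.AutOver f) | Finite H ∧
      (CurveAction.stabilizedLocus f H).Nonempty ∧
      CurveAction.stabilizedLocus f H ⊆ S}.Finite := by
  have hT : (⋃ x ∈ S, ⋃ y ∈ S, {g : CurveAction.AutOver f | g • x = y}).Finite :=
    hS.biUnion fun x hx => hS.biUnion fun y _ =>
      CurveAction.finite_setOf_smul_eq_point f hgenus (hSc hx) y
  -- A subgroup is determined by its underlying set, here a subset of a fixed finite set.
  refine (hT.finite_subsets.preimage SetLike.coe_injective.injOn).subset fun H hH => ?_
  obtain ⟨-, ⟨x, hx⟩, hHS⟩ := hH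
  intro g hg
  exact Set.mem_biUnion (hHS hx) (Set.mem_biUnion
    (hHS (CurveAction.smul_mem_stabilizedLocus f hg hx)) rfl)
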